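/- Fix $\rho\in(0,1)$. For a signal $x=(x_0,x_1,\dots)$ with values in a Euclidean space $\mathbb R^d$ let $\|x\|_\rho^2=\sum_{k\ge 0}\rho^{-2k}|x_k|^2$, let $\ell_2^\rho$ be the set of signals with $\|x\|_\rho<\infty$, and for $x\in\ell_2^\rho$ and $|z|=1$ let $\hat x(\rho z)=\sum_{k\ge0}x_k\rho^{-k}z^{-k}$ (convergence in $L^2$ of the unit circle $\mathbb T$). Let $G$ be an $m\times n$ matrix of proper rational functions with real coefficients such that $z\mapsto G(\rho z)$ has no pole in $|z|\ge 1$ (that is, $G(\rho z)\in RH_\infty^{m\times n}$), and let $(A,B,C,D)$ be a minimal realization of $G$, with $x_{k+1}=Ax_k+Bu_k$, $y_k=Cx_k+Du_k$. Let $\Delta$ be a causal operator from $\mathbb R^m$-valued signals to $\mathbb R^n$-valued signals that is bounded on $\ell_2^\rho$: there is $\gamma$ with $\Delta(y)\in\ell_2^\rho$ and $\|\Delta(y)\|_\rho\le\gamma\|y\|_\rho$ for all $y\in\ell_2^\rho$. Let $\Pi$ be an $(m+n)\times(m+n)$ complex matrix function for which $z\mapsto\Pi(\rho z)$ is Hermitian,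 measurable and essentially bounded on $\mathbb T$. Suppose that: 1. for every $\tau\in[0,1]$ the interconnection of $G$ and $\tau\Delta$ is well-posed: with $G$ started from the zero state, the map $(v,w)\mapsto(e,f)=(w-\tau\Delta(v),\,v-Gw)$ on the space of all pairs of signals has a causal inverse; 2. for every $\tau\in[0,1]$ we have $\tau\Delta\in\mathrm{IQC}(\Pi(z),\rho)$: for all $y\in\ell_2^\rho$, with $u=\tau\Delta(y)$, $$\int_{\mathbb T}\begin{bmatrix}\hat y(\rho z)\\ \hat u(\rho z)\end{bmatrix}^*\Pi(\rho z)\begin{bmatrix}\hat y(\rho z)\\ \hat u(\rho z)\end{bmatrix}|dz|\ \ge 0;$$ 3. there is $\varepsilon>0$ such that $$\begin{bmatrix}G(\rho z)\\ I\end{bmatrix}^*\Pi(\rho z)\begin{bmatrix}G(\rho z)\\ I\end{bmatrix}\preceq-\varepsilon I\qquad\text{for all }z\in\mathbb T.$$ Then the feedback loop of $G$ and $\Delta$ without external inputs, $x_{k+1}=Ax_k+Bu_k$, $y_k=Cx_k+Du_k$, $u=\Delta(y)$, is exponentially stable with rate $\rho$: there is $c>0$ such that for every initial state $x_0$ the loop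 has a solution, and every solution satisfies $\|x_k\|\le c\,\rho^k\|x_0\|$ for all $k\ge0$. -/

import Mathlib

open MeasureTheory AddCircle
open scoped ENNReal ComplexOrder

namespace RhoIQC

noncomputable section

/-! ### Signals -/

/-- One-sided discrete-time signals `x = (x₀, x₁, …)` with values in Euclidean `ℝᵈ`. -/
abbrev Signal (d : ℕ) : Type := ℕ → EuclideanSpace ℝ (Fin d)

/-- `x ∈ ℓ₂^ρ`, i.e. `∑ ρ^{-2k} |x_k|² < ∞`. -/
def MemEll2 (ρ : ℝ) {d : ℕ} (x : Signal d) : Prop :=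
  Summable fun k : ℕ => (ρ⁻¹ ^ k * ‖x k‖) ^ 2

/-- The squared `ℓ₂^ρ` norm `∑ ρ^{-2k} |x_k|²` (meaningful for `x ∈ ℓ₂^ρ`). -/
def ell2NormSq (ρ : ℝ) {d : ℕ} (x : Signal d) : ℝ :=
  ∑' k : ℕ, (ρ⁻¹ ^ k * ‖x k‖) ^ 2

/-- A map between signal spaces is causal if the output at time `T` depends only on the input
at the times `0, …, T`. -/
def Causal {α β : Type} (F : (ℕ → α) → (ℕ → β)) : Prop :=
  ∀ (p q : ℕ → α) (T : ℕ), (∀ k ≤ T, p k = q k) → F p T = F q T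

/-- `Δ` is a bounded operator on `ℓ₂^ρ`: it maps `ℓ₂^ρ` into itself with finite gain. -/
def BoundedOn (ρ : ℝ) {m n : ℕ} (Δ : Signal m → Signal n) : Prop :=
  ∃ γ : ℝ, ∀ y : Signal m, MemEll2 ρ y →
    MemEll2 ρ (Δ y) ∧ ell2NormSq ρ (Δ y) ≤ γ ^ 2 * ell2NormSq ρ y

/-! ### Transfer matrices -/

/-- Value of a real rational `m × n` matrix at the complex point `z`. -/
def evalAt {m n : ℕ} (G : Matrix (Fin m) (Fin n) (RatFunc ℝ)) (z : ℂ) :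
    Matrix (Fin m) (Fin n) ℂ :=
  G.map fun g => RatFunc.eval (algebraMap ℝ ℂ) z g

/-- `G(ρz) ∈ RH_∞^{m×n}`: every entry is a proper rational function with real coefficients, and
`z ↦ G(ρz)` has no pole in `|z| ≥ 1` (with the transform `∑ x_k z^{-k}`, this is stability).
`num` and `denom` are coprime, so the poles are the zeros of `denom`. -/
def ScaledRHInf (ρ : ℝ) {m n : ℕ} (G : Matrix (Fin m) (Fin n) (RatFunc ℝ)) : Prop :=
  ∀ i j, (G i j).num.natDegree ≤ (G i j).denom.natDegree ∧
    ∀ z : ℂ, 1 ≤ ‖z‖ → (G i j).denom.eval₂ (algebraMap ℝ ℂ) ((ρ : ℂ) * z) ≠ 0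

/-- The matrices of a system `x_{k+1} = A x_k + B u_k`, `y_k = C x_k + D u_k` with `N` states,
`n` inputs and `m` outputs. -/
structure StateSpace (m n N : ℕ) where
  A : Matrix (Fin N) (Fin N) ℝ
  B : Matrix (Fin N) (Fin n) ℝ
  C : Matrix (Fin m) (Fin N) ℝ
  D : Matrix (Fin m) (Fin n) ℝ

namespace StateSpace

variable {m n N : ℕ}

/-- The transfer matrix `C (zI - A)⁻¹ B + D`. -/
def transferMatrix (S : StateSpace m n N) : Matrix (Fin m) (Fin n) (RatFunc ℝ) :=
  S.C.map (RatFunc.C (K := ℝ)) *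
      ((RatFunc.X : RatFunc ℝ) • (1 : Matrix (Fin N) (Fin N) (RatFunc ℝ)) - S.A.map (RatFunc.C (K := ℝ)))⁻¹ *
      S.B.map (RatFunc.C (K := ℝ)) +
    S.D.map (RatFunc.C (K := ℝ))

/-- `S` is a realization of `G` with the least possible number of states. -/
def IsMinimalRealization (S : StateSpace m n N) (G : Matrix (Fin m) (Fin n) (RatFunc ℝ)) : Prop :=
  S.transferMatrix = G ∧
    ∀ (N' : ℕ) (S' : StateSpace m n N'), S'.transferMatrix = G → N ≤ N'

/-- The state trajectory with initial state `x₀` and input `u`. -/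
def stateSeq (S : StateSpace m n N) (x₀ : EuclideanSpace ℝ (Fin N)) (u : Signal n) : Signal N
  | 0 => x₀
  | k + 1 => S.A.toEuclideanLin (stateSeq S x₀ u k) + S.B.toEuclideanLin (u k)

/-- The output with initial state `x₀` and input `u`. -/
def output (S : StateSpace m n N) (x₀ : EuclideanSpace ℝ (Fin N)) (u : Signal n) : Signal m :=
  fun k => S.C.toEuclideanLin (S.stateSeq x₀ u k) + S.D.toEuclideanLin (u k)

end StateSpace

/-! ### The feedback interconnection `v = G w + f`, `w = Δ(v) + e` -/

/-- The map `(v, w) ↦ (e, f) = (w - Δ(v), v - G w)`, where `G` starts from the zero state. -/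
def loopMap {m n N : ℕ} (S : StateSpace m n N) (Δ : Signal m → Signal n)
    (p : ℕ → EuclideanSpace ℝ (Fin m) × EuclideanSpace ℝ (Fin n)) :
    ℕ → EuclideanSpace ℝ (Fin n) × EuclideanSpace ℝ (Fin m) :=
  fun k =>
    ((p k).2 - Δ (fun j => (p j).1) k, (p k).1 - S.output 0 (fun j => (p j).2) k)

/-- The interconnection is well-posed: `(v, w) ↦ (e, f)` has a causal inverse on the space of
all signals. -/
def WellPosed {m n N : ℕ} (S : StateSpace m n N) (Δ : Signal m → Signal n) : Prop :=
  ∃ H, Function.LeftInverse H (loopMap S Δ) ∧ Function.RightInverse H (loopMap S Δ) ∧ Causal H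

/-- `u` is the input of `G` in the loop without external inputs (`e = 0`, `f = 0`) when `G`
starts from the state `x₀`. -/
def IsFreeSolution {m n N : ℕ} (S : StateSpace m n N) (Δ : Signal m → Signal n)
    (x₀ : EuclideanSpace ℝ (Fin N)) (u : Signal n) : Prop :=
  u = Δ (S.output x₀ u)

/-- The interconnection is exponentially stable with rate `ρ`: from every initial state `x₀` the
loop with `e = 0`, `f = 0` has a solution, and the state of `G` always satisfies
`‖x_k‖ ≤ c ρ^k ‖x₀‖`, with one constant `c > 0` for all initial states. -/
def ExponentiallyStable {m n N : ℕ} (S : StateSpace m n N) (Δ : Signal m → Signal n)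
    (ρ : ℝ) : Prop :=
  ∃ c : ℝ, 0 < c ∧ ∀ x₀ : EuclideanSpace ℝ (Fin N),
    (∃ u, IsFreeSolution S Δ x₀ u) ∧
    ∀ u, IsFreeSolution S Δ x₀ u → ∀ k, ‖S.stateSeq x₀ u k‖ ≤ c * ρ ^ k * ‖x₀‖

/-! ### The `ρ`-IQC

The unit circle is parametrized by `t ∈ ℝ/ℤ`, `z = e^{2πit}`, with normalized arc length. -/

/-- The point `z = e^{2πit}` of the unit circle. -/
def circlePt (t : UnitAddCircle) : ℂ := (toCircle t : ℂ)

/-- The `i`-th component of `z ↦ x̂(ρz) = ∑ x_k ρ^{-k} z^{-k}` on the unit circle, for `x ∈ ℓ₂^ρ`.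
The series converges in `L²` of the circle; `fourierLp 2 (-k)` is the class of `z^{-k}`. -/
def zTransform (ρ : ℝ) {d : ℕ} (x : Signal d) (i : Fin d) :
    Lp ℂ 2 (haarAddCircle (T := (1 : ℝ))) :=
  ∑' k : ℕ, ((ρ⁻¹ ^ k * x k i : ℝ) : ℂ) • fourierLp 2 (-(k : ℤ))

/-- The stacked vector `(ŷ(ρz), û(ρz))` at `z = e^{2πit}`. -/
def stacked (ρ : ℝ) {m n : ℕ} (y : Signal m) (u : Signal n) (t : UnitAddCircle) :
    Fin m ⊕ Fin n → ℂ :=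
  Sum.elim (fun i => zTransform ρ y i t) (fun j => zTransform ρ u j t)

/-- On the circle of radius `ρ`, `Π` is Hermitian, measurable and essentially bounded. -/
def IsMultiplier (ρ : ℝ) {m n : ℕ}
    (P : ℂ → Matrix (Fin m ⊕ Fin n) (Fin m ⊕ Fin n) ℂ) : Prop :=
  (∀ z : ℂ, ‖z‖ = 1 → (P ((ρ : ℂ) * z)).IsHermitian) ∧
    ∀ i j, MemLp (fun t : UnitAddCircle => P ((ρ : ℂ) * circlePt t) i j) ∞
      (haarAddCircle (T := (1 : ℝ)))

/-- The signals `y, u ∈ ℓ₂^ρ` satisfy the `ρ`-IQC defined by `Π`. The integrand is a Hermitian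
form, hence real, and it is integrable when `Π` is essentially bounded. -/
def SignalsSatisfyIQC (ρ : ℝ) {m n : ℕ}
    (P : ℂ → Matrix (Fin m ⊕ Fin n) (Fin m ⊕ Fin n) ℂ) (y : Signal m) (u : Signal n) : Prop :=
  MemEll2 ρ y ∧ MemEll2 ρ u ∧
    0 ≤ ∫ t : UnitAddCircle,
      (star (stacked ρ y u t) ⬝ᵥ
        (P ((ρ : ℂ) * circlePt t)).mulVec (stacked ρ y u t)).re ∂haarAddCircle

/-- `Δ ∈ IQC(Π(z), ρ)`. -/
def SatisfiesIQC (ρ : ℝ) {m n : ℕ}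
    (P : ℂ → Matrix (Fin m ⊕ Fin n) (Fin m ⊕ Fin n) ℂ) (Δ : Signal m → Signal n) : Prop :=
  ∀ y : Signal m, MemEll2 ρ y → SignalsSatisfyIQC ρ P y (Δ y)

/-- The block column `[G(ρz); I]`. -/
def graphMatrix (ρ : ℝ) {m n : ℕ} (G : Matrix (Fin m) (Fin n) (RatFunc ℝ)) (z : ℂ) :
    Matrix (Fin m ⊕ Fin n) (Fin n) ℂ :=
  Matrix.fromRows (evalAt G ((ρ : ℂ) * z)) 1

/-- The frequency-domain inequality
`[G(ρz); I]* Π(ρz) [G(ρz); I] ⪯ -ε I` for all `|z| = 1`. -/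
def FrequencyDomainInequality (ρ ε : ℝ) {m n : ℕ}
    (G : Matrix (Fin m) (Fin n) (RatFunc ℝ))
    (P : ℂ → Matrix (Fin m ⊕ Fin n) (Fin m ⊕ Fin n) ℂ) : Prop :=
  ∀ z : ℂ, ‖z‖ = 1 →
    (-((ε : ℂ) • (1 : Matrix (Fin n) (Fin n) ℂ)) -
      (graphMatrix ρ G z).conjTranspose * P ((ρ : ℂ) * z) * graphMatrix ρ G z).PosSemidef

end

end RhoIQC

/-!
The signals `y, u` of a free trajectory solve the loop equations of the zero initial state with the
external input `f = C Aᵏ x₀`, so exponential stability with rate `ρ` follows from a gain bound of the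
loop in `ℓ₂^ρ`.

*The plant.* By minimality the vectors `Aᵏ B eⱼ`, and dually `(Aᵀ)ᵏ Cᵀ eᵢ`, span the state space, so
every entry of `Aᵏ` is a fixed combination of Markov parameters `C Aᵏ⁺ⁱ B`. These are the Taylor
coefficients at infinity of `G`, which is holomorphic on a neighbourhood of `|z| ≥ ρ`; hence
`∑ ρ^{-k} ‖Aᵏ x‖ < ∞` (`summable_norm_pow`). This gives a norm in which `A` has operator norm
less than `ρ`, and from it bounds of state and output over every finite horizon by the initial state and the
input (`exists_energy_stateSeq_le`, `exists_energy_output_le`). It also makes `ρz - A` invertible on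
the unit circle, so that the transform of the zero-state response is `G(ρz) û(ρz)` almost everywhere
(`zTransform_output_ae`).

*The a priori bound.* Suppose `v = G w + f` with `w = τΔ(v)` and all signals lie in `ℓ₂^ρ`. Then
`[v̂; ŵ] = [G; I] ŵ + [f̂; 0]`; the constraint bounds the integrated quadratic form of the left side from
below by `0`, the frequency domain inequality bounds its main part from above by `-ε ‖w‖²`, and absorbing
the cross terms leaves `‖v‖² ≤ c ‖f‖²` with `c` independent of `τ`
(`exists_ell2NormSq_le_of_iqc`).

*The homotopy.* At `τ = 0` the loop equation is `v = f`. If at `τ` every `f ∈ ℓ₂^ρ` has its solution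
in `ℓ₂^ρ`, then the same holds at every `τ'` within a distance of `τ` that depends only on the gains
and on `c`: truncate the equation, and use that the well-posed loop is causal
(`memEll2_of_nearby`). Finitely many steps reach `τ = 1`. With `f = C Aᵏ x₀`, of norm at most a multiple of
`‖x₀‖`, the state bound then gives `ρ^{-k} ‖x_k‖ ≤ const · ‖x₀‖`.
-/

namespace RhoIQC


/-! ### Transfer matrices as quotients of polynomial matrices -/

namespace StateSpace

open Polynomial

variable {m n N : ℕ}

/-- The polynomial matrix `C adj(zI - A) B + χ_A(z) D`, whose quotient by the characteristic
polynomial `χ_A` is the transfer matrix. -/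
noncomputable def numerator (S : StateSpace m n N) : Matrix (Fin m) (Fin n) ℝ[X] :=
  S.C.map Polynomial.C * (Matrix.charmatrix S.A).adjugate * S.B.map Polynomial.C +
    S.A.charpoly • S.D.map Polynomial.C

/-- Both the transfer matrix over `ℝ(X)` and its values at complex points are images of the same
polynomial identity, under `ℝ[X] → ℝ(X)` and under evaluation respectively. -/
lemma map_numerator {K : Type*} [Field K] (S : StateSpace m n N) (φ : ℝ[X] →+* K)
    (hφ : φ S.A.charpoly ≠ 0) (i : Fin m) (j : Fin n) :
    (S.C.map (fun r => φ (Polynomial.C r)) * (φ.mapMatrix (Matrix.charmatrix S.A))⁻¹ *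
        S.B.map (fun r => φ (Polynomial.C r)) + S.D.map (fun r => φ (Polynomial.C r))) i j *
      φ S.A.charpoly = φ (S.numerator i j) := by
  have hdet : (φ.mapMatrix (Matrix.charmatrix S.A)).det = φ S.A.charpoly := by
    rw [← RingHom.map_det]; rfl
  have hnum : φ (S.numerator i j) = (S.numerator.map φ) i j := rfl
  rw [hnum, numerator, Matrix.map_add _ (map_add φ), Matrix.map_mul, Matrix.map_mul,
    Matrix.inv_def, hdet, ← RingHom.mapMatrix_apply φ (Matrix.adjugate _), RingHom.map_adjugate,
    Ring.inverse_eq_inv]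
  simp only [Matrix.add_apply, Matrix.mul_smul, Matrix.smul_mul, Matrix.smul_apply, smul_eq_mul,
    Matrix.map_map, Matrix.map_apply, Function.comp_def, map_mul]
  field_simp

lemma map_charmatrix_eq {K : Type*} [CommRing K] (A : Matrix (Fin N) (Fin N) ℝ) (φ : ℝ[X] →+* K) :
    φ.mapMatrix (Matrix.charmatrix A) =
      φ X • (1 : Matrix (Fin N) (Fin N) K) - A.map (fun r => φ (Polynomial.C r)) := by
  ext i j
  by_cases h : i = j
  · subst h; simp
  · simp [h]

/-- Away from the eigenvalues of `A` and the poles of the transfer matrix, evaluating the entries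
of the transfer matrix agrees with `C (zI - A)⁻¹ B + D`. -/
lemma evalAt_transferMatrix (S : StateSpace m n N) (z : ℂ)
    (hz : (z • (1 : Matrix (Fin N) (Fin N) ℂ) - S.A.map (algebraMap ℝ ℂ)).det ≠ 0)
    (i : Fin m) (j : Fin n)
    (hd : (S.transferMatrix i j).denom.eval₂ (algebraMap ℝ ℂ) z ≠ 0) :
    evalAt S.transferMatrix z i j =
      (S.C.map (algebraMap ℝ ℂ) * (z • (1 : Matrix (Fin N) (Fin N) ℂ) -
        S.A.map (algebraMap ℝ ℂ))⁻¹ * S.B.map (algebraMap ℝ ℂ) + S.D.map (algebraMap ℝ ℂ)) i j := by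
  have hχ0 : algebraMap ℝ[X] (RatFunc ℝ) S.A.charpoly ≠ 0 := by
    simpa using S.A.charpoly_monic.ne_zero
  have h1 := map_numerator S (algebraMap ℝ[X] (RatFunc ℝ)) hχ0 i j
  rw [map_charmatrix_eq] at h1
  have h1' : S.transferMatrix i j * algebraMap ℝ[X] (RatFunc ℝ) S.A.charpoly =
      algebraMap ℝ[X] (RatFunc ℝ) (S.numerator i j) := by
    rw [← h1]
    simp only [RatFunc.algebraMap_X, RatFunc.algebraMap_C]
    rfl
  set g := S.transferMatrix i j with hg
  have hpoly : g.num * S.A.charpoly = S.numerator i j * g.denom := by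
    apply RatFunc.algebraMap_injective ℝ
    rw [map_mul, map_mul, ← h1']
    nth_rw 2 [← RatFunc.num_div_denom g]
    have : algebraMap ℝ[X] (RatFunc ℝ) g.denom ≠ 0 := by
      simpa using g.denom_ne_zero
    field_simp
  let ψ : ℝ[X] →+* ℂ := eval₂RingHom (algebraMap ℝ ℂ) z
  have hM : ψ.mapMatrix (Matrix.charmatrix S.A) =
      z • (1 : Matrix (Fin N) (Fin N) ℂ) - S.A.map (algebraMap ℝ ℂ) := by
    rw [map_charmatrix_eq]
    simp [ψ]
  have hψ : ψ S.A.charpoly ≠ 0 := by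
    rw [← hM, ← RingHom.map_det] at hz
    exact hz
  have h2 := map_numerator S ψ hψ i j
  rw [hM] at h2
  have h2' : (S.C.map (algebraMap ℝ ℂ) * (z • (1 : Matrix (Fin N) (Fin N) ℂ) -
        S.A.map (algebraMap ℝ ℂ))⁻¹ * S.B.map (algebraMap ℝ ℂ) +
        S.D.map (algebraMap ℝ ℂ)) i j * ψ S.A.charpoly = ψ (S.numerator i j) := by
    rw [← h2]
    simp [ψ]
  have h3 := congrArg ψ hpoly
  rw [map_mul, map_mul, ← h2'] at h3
  have hd' : ψ g.denom ≠ 0 := hd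
  change ψ g.num / ψ g.denom = _
  rw [div_eq_iff hd']
  apply mul_right_cancel₀ hψ
  rw [h3]; ring

/-! ### Minimal realizations are controllable and observable -/

lemma det_resolvent_ne_zero (A : Matrix (Fin N) (Fin N) ℝ) :
    ((RatFunc.X : RatFunc ℝ) • (1 : Matrix (Fin N) (Fin N) (RatFunc ℝ)) -
      A.map (RatFunc.C (K := ℝ))).det ≠ 0 := by
  have h := map_charmatrix_eq A (algebraMap ℝ[X] (RatFunc ℝ))
  simp only [RatFunc.algebraMap_X, RatFunc.algebraMap_C] at h
  have h' : (algebraMap ℝ[X] (RatFunc ℝ)).mapMatrix (Matrix.charmatrix A) =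
    (RatFunc.X : RatFunc ℝ) • (1 : Matrix (Fin N) (Fin N) (RatFunc ℝ)) -
      A.map (RatFunc.C (K := ℝ)) := h
  rw [← h', ← RingHom.map_det]
  simpa [Matrix.charpoly] using A.charpoly_monic.ne_zero

/-- Systems whose state spaces are intertwined by a matrix `T` have the same transfer matrix. -/
lemma transferMatrix_eq_of_intertwine {N' : ℕ} (S : StateSpace m n N) (S' : StateSpace m n N')
    (T : Matrix (Fin N) (Fin N') ℝ) (hA : S.A * T = T * S'.A) (hB : T * S'.B = S.B)
    (hC : S'.C = S.C * T) (hD : S'.D = S.D) : S'.transferMatrix = S.transferMatrix := by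
  unfold transferMatrix
  set c := (RatFunc.C (K := ℝ))
  set R : Matrix (Fin N) (Fin N) (RatFunc ℝ) := (RatFunc.X : RatFunc ℝ) • 1 - S.A.map c with hR
  set R' : Matrix (Fin N') (Fin N') (RatFunc ℝ) := (RatFunc.X : RatFunc ℝ) • 1 - S'.A.map c with hR'
  have hRu : IsUnit R.det := isUnit_iff_ne_zero.mpr (det_resolvent_ne_zero S.A)
  have hRu' : IsUnit R'.det := isUnit_iff_ne_zero.mpr (det_resolvent_ne_zero S'.A)
  have h1 : R * T.map c = T.map c * R' := by
    rw [hR, hR', Matrix.sub_mul, Matrix.mul_sub, ← Matrix.map_mul, ← Matrix.map_mul, hA]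
    simp
  have h2 : T.map c * R'⁻¹ = R⁻¹ * T.map c := by
    calc T.map c * R'⁻¹ = R⁻¹ * (R * T.map c) * R'⁻¹ := by
          rw [Matrix.nonsing_inv_mul_cancel_left _ _ hRu]
      _ = R⁻¹ * T.map c := by
          rw [h1, ← Matrix.mul_assoc, Matrix.mul_nonsing_inv_cancel_right _ _ hRu']
  rw [hC, hD, ← hB, Matrix.map_mul, Matrix.map_mul, Matrix.mul_assoc (S.C.map c), h2]
  simp only [Matrix.mul_assoc]

/-- The span of the columns of `B, AB, A²B, …`. -/
noncomputable def reachable (S : StateSpace m n N) : Submodule ℝ (Fin N → ℝ) :=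
  Submodule.span ℝ (Set.range fun p : ℕ × Fin n => (S.A ^ p.1).mulVec (S.B.col p.2))

lemma mulVec_mem_reachable (S : StateSpace m n N) {x : Fin N → ℝ} (hx : x ∈ S.reachable) :
    S.A.mulVec x ∈ S.reachable := by
  have : S.reachable ≤ S.reachable.comap S.A.mulVecLin := by
    refine Submodule.span_le.mpr ?_
    rintro _ ⟨p, rfl⟩
    refine Submodule.subset_span ⟨(p.1 + 1, p.2), ?_⟩
    simp [pow_succ', Matrix.mulVec_mulVec]
  exact this hx

/-- A minimal realization is controllable: restricting the system to its reachable subspace does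
not change the transfer matrix. -/
lemma IsMinimalRealization.reachable_eq_top {S : StateSpace m n N}
    {G : Matrix (Fin m) (Fin n) (RatFunc ℝ)} (hS : S.IsMinimalRealization G) :
    S.reachable = ⊤ := by
  by_contra hne
  have hlt := Submodule.finrank_lt hne
  rw [Module.finrank_fin_fun] at hlt
  let W := S.reachable
  let b := Module.finBasis ℝ W
  let a : W →ₗ[ℝ] W := S.A.mulVecLin.restrict fun x hx => S.mulVec_mem_reachable hx
  have hBmem : ∀ v, S.B.mulVec v ∈ W := by
    intro v
    rw [Matrix.mulVec_eq_sum]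
    simp only [op_smul_eq_smul]
    refine sum_mem fun j _ => W.smul_mem _ ?_
    exact Submodule.subset_span ⟨(0, j), by simp [Matrix.col]⟩
  let β : (Fin n → ℝ) →ₗ[ℝ] W := S.B.mulVecLin.codRestrict W hBmem
  let e (k : ℕ) := Pi.basisFun ℝ (Fin k)
  let T := LinearMap.toMatrix b (e N) W.subtype
  have hmat {k l : ℕ} (M : Matrix (Fin k) (Fin l) ℝ) :
      M = LinearMap.toMatrix (e l) (e k) M.mulVecLin :=
    (LinearMap.toMatrix_toLin (e l) (e k) M).symm
  let S' : StateSpace m n (Module.finrank ℝ W) :=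
    ⟨LinearMap.toMatrix b b a, LinearMap.toMatrix (e n) b β, S.C * T, S.D⟩
  have hA : S.A * T = T * S'.A := by
    rw [hmat S.A, ← LinearMap.toMatrix_comp, ← LinearMap.toMatrix_comp]
    rfl
  have hB : T * S'.B = S.B := by
    rw [hmat S.B, ← LinearMap.toMatrix_comp]
    rfl
  have := transferMatrix_eq_of_intertwine S S' T hA hB rfl rfl
  exact absurd (hS.2 _ S' (this.trans hS.1)) (not_le.mpr hlt)

/-- The dual system. -/
def dual (S : StateSpace m n N) : StateSpace n m N :=
  ⟨S.A.transpose, S.C.transpose, S.B.transpose, S.D.transpose⟩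

lemma transferMatrix_dual (S : StateSpace m n N) :
    S.dual.transferMatrix = S.transferMatrix.transpose := by
  simp only [transferMatrix, dual, Matrix.transpose_add, Matrix.transpose_mul,
    Matrix.transpose_nonsing_inv, Matrix.transpose_sub, Matrix.transpose_smul,
    Matrix.transpose_one, Matrix.transpose_map, Matrix.mul_assoc]

lemma IsMinimalRealization.dual {S : StateSpace m n N}
    {G : Matrix (Fin m) (Fin n) (RatFunc ℝ)} (hS : S.IsMinimalRealization G) :
    S.dual.IsMinimalRealization G.transpose := by
  refine ⟨by rw [transferMatrix_dual, hS.1], fun N' S' h => hS.2 N' S'.dual ?_⟩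
  rw [transferMatrix_dual, h, Matrix.transpose_transpose]

end StateSpace


/-! ### Decay of the Markov parameters and of the powers of `A` -/

section Analytic

open Polynomial Filter Topology

attribute [local instance] Matrix.linftyOpNormedRing Matrix.linftyOpNormedAlgebra

/-- A proper rational function without poles in `|z| ≥ ρ` becomes, in the variable `w = 1 / z`, a
quotient of polynomials that is holomorphic on a disc of radius greater than `1 / ρ`. -/
lemma exists_differentiableOn_of_proper {ρ : ℝ} (hρ : 0 < ρ) (g : RatFunc ℝ)
    (hdeg : g.num.natDegree ≤ g.denom.natDegree)
    (hpole : ∀ z : ℂ, 1 ≤ ‖z‖ → g.denom.eval₂ (algebraMap ℝ ℂ) ((ρ : ℂ) * z) ≠ 0) :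
    ∃ (f : ℂ → ℂ) (R : ℝ), ρ⁻¹ < R ∧ DifferentiableOn ℂ f (Metric.ball 0 R) ∧
      ∀ w, w ≠ 0 → f w = RatFunc.eval (algebraMap ℝ ℂ) w⁻¹ g := by
  set d := g.denom.natDegree
  let p := (reflect d g.num).map (algebraMap ℝ ℂ)
  let q := (reflect d g.denom).map (algebraMap ℝ ℂ)
  have hp : ∀ w : ℂ, w ≠ 0 → p.eval w * w⁻¹ ^ d = g.num.eval₂ (algebraMap ℝ ℂ) w⁻¹ := by
    intro w hw
    let _ : Invertible w⁻¹ := invertibleOfNonzero (inv_ne_zero hw)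
    have := eval₂_reflect_mul_pow (algebraMap ℝ ℂ) w⁻¹ d g.num hdeg
    rwa [invOf_eq_inv, inv_inv, ← eval_map] at this
  have hq : ∀ w : ℂ, w ≠ 0 → q.eval w * w⁻¹ ^ d = g.denom.eval₂ (algebraMap ℝ ℂ) w⁻¹ := by
    intro w hw
    let _ : Invertible w⁻¹ := invertibleOfNonzero (inv_ne_zero hw)
    have := eval₂_reflect_mul_pow (algebraMap ℝ ℂ) w⁻¹ d g.denom le_rfl
    rwa [invOf_eq_inv, inv_inv, ← eval_map] at this
  have hq0 : ∀ w ∈ Metric.closedBall (0 : ℂ) ρ⁻¹, q.eval w ≠ 0 := by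
    intro w hw
    by_cases h0 : w = 0
    · subst h0
      rw [← coeff_zero_eq_eval_zero, coeff_map, coeff_reflect]
      simp [d, revAt_le, g.denom_ne_zero]
    · intro h
      have h1 := hq w h0
      rw [h, zero_mul] at h1
      have hρ' : (ρ : ℂ) ≠ 0 := by exact_mod_cast hρ.ne'
      refine hpole (((ρ : ℂ) * w)⁻¹) ?_ ?_
      · rw [norm_inv, norm_mul, Complex.norm_real, Real.norm_of_nonneg hρ.le]
        rw [mem_closedBall_zero_iff] at hw
        have hpos : 0 < ρ * ‖w‖ := mul_pos hρ (norm_pos_iff.mpr h0)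
        rw [one_le_inv₀ hpos]
        calc ρ * ‖w‖ ≤ ρ * ρ⁻¹ := by gcongr
          _ = 1 := mul_inv_cancel₀ hρ.ne'
      · rw [h1]
        congr 1
        field_simp
  have hopen : IsOpen {w : ℂ | q.eval w ≠ 0} :=
    isOpen_ne_fun q.continuous continuous_const
  obtain ⟨δ, hδ, hsub⟩ :=
    (isCompact_closedBall (0 : ℂ) ρ⁻¹).exists_thickening_subset_open hopen hq0
  rw [thickening_closedBall hδ (by positivity)] at hsub
  refine ⟨fun w => p.eval w / q.eval w, δ + ρ⁻¹, by linarith, ?_, ?_⟩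
  · exact p.differentiable.differentiableOn.div q.differentiable.differentiableOn
      fun w hw => hsub hw
  · intro w hw
    rw [RatFunc.eval, ← hp w hw, ← hq w hw]
    have : w⁻¹ ^ d ≠ 0 := pow_ne_zero _ (inv_ne_zero hw)
    rw [mul_div_mul_right _ _ this]

variable {m n N : ℕ}

/-- The expansion `C (w⁻¹ I - A)⁻¹ B + D = D + w ∑ₖ wᵏ C Aᵏ B` converges near `w = 0`, and the left
side continues to a disc of radius greater than `1 / ρ`, so the Cauchy estimates bound the Markov
parameters `C Aᵏ B`. -/
lemma summable_markov {ρ : ℝ} (hρ : 0 < ρ) (S : StateSpace m n N)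
    (hG : ScaledRHInf ρ S.transferMatrix) (i : Fin m) (j : Fin n) :
    Summable fun k : ℕ => ρ⁻¹ ^ k * |(S.C * S.A ^ k * S.B) i j| := by
  obtain ⟨f, R, hR, hf, hfg⟩ :=
    exists_differentiableOn_of_proper hρ _ (hG i j).1 (hG i j).2
  have hρi : 0 < ρ⁻¹ := inv_pos.mpr hρ
  have hR0 : 0 < R := hρi.trans hR
  let c := algebraMap ℝ ℂ
  let A : Matrix (Fin N) (Fin N) ℂ := S.A.map c
  let L₀ : Matrix (Fin N) (Fin N) ℂ →ₗ[ℂ] ℂ :=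
    { toFun := fun M => (S.C.map c * M * S.B.map c) i j
      map_add' := fun M M' => by simp [Matrix.mul_add, Matrix.add_mul]
      map_smul' := fun r M => by simp }
  let L : Matrix (Fin N) (Fin N) ℂ →L[ℂ] ℂ := LinearMap.toContinuousLinearMap L₀
  let h : ℂ → ℂ := fun w => L (Ring.inverse (1 - w • A))
  let ph : FormalMultilinearSeries ℂ ℂ ℂ := L.compFormalMultilinearSeries
    fun n => ContinuousMultilinearMap.mkPiRing ℂ (Fin n) (A ^ n)
  have hh : HasFPowerSeriesAt h ph 0 :=
    (L.comp_hasFPowerSeriesOnBall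
      (spectrum.hasFPowerSeriesOnBall_inverse_one_sub_smul ℂ A)).hasFPowerSeriesAt
  have hfan : AnalyticAt ℂ f 0 := hf.analyticAt (Metric.ball_mem_nhds _ hR0)
  have hev : ∀ᶠ w in 𝓝[≠] (0 : ℂ), f w = c (S.D i j) + w * h w := by
    have h1 : ∀ᶠ w in 𝓝 (0 : ℂ), ‖w • A‖ < 1 := by
      have : Tendsto (fun w : ℂ => ‖w • A‖) (𝓝 0) (𝓝 ‖(0 : ℂ) • A‖) :=
        ((continuous_id.smul continuous_const).norm).tendsto 0
      exact this.eventually (gt_mem_nhds (by simp))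
    have h2 : ∀ᶠ w in 𝓝 (0 : ℂ), w ∈ Metric.ball (0 : ℂ) ρ⁻¹ := Metric.ball_mem_nhds _ hρi
    filter_upwards [h1.filter_mono nhdsWithin_le_nhds, h2.filter_mono nhdsWithin_le_nhds,
      self_mem_nhdsWithin] with w hw1 hw2 hw0
    replace hw0 : w ≠ 0 := hw0
    have hu : IsUnit (1 - w • A) := isUnit_one_sub_of_norm_lt_one hw1
    have hu' : IsUnit (1 - w • A).det := (Matrix.isUnit_iff_isUnit_det _).mp hu
    have hfac : w⁻¹ • (1 : Matrix (Fin N) (Fin N) ℂ) - A = w⁻¹ • (1 - w • A) := by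
      rw [smul_sub, smul_smul, inv_mul_cancel₀ hw0, one_smul]
    have hinv : (w⁻¹ • (1 : Matrix (Fin N) (Fin N) ℂ) - A)⁻¹ = w • (1 - w • A)⁻¹ := by
      apply Matrix.inv_eq_right_inv
      rw [hfac, Matrix.smul_mul, Matrix.mul_smul, smul_smul, inv_mul_cancel₀ hw0, one_smul,
        Matrix.mul_nonsing_inv _ hu']
    have hdet : (w⁻¹ • (1 : Matrix (Fin N) (Fin N) ℂ) - A).det ≠ 0 := by
      rw [hfac, Matrix.det_smul]
      exact mul_ne_zero (pow_ne_zero _ (inv_ne_zero hw0)) hu'.ne_zero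
    have hden : (S.transferMatrix i j).denom.eval₂ (algebraMap ℝ ℂ) w⁻¹ ≠ 0 := by
      have hρ' : (ρ : ℂ) ≠ 0 := by exact_mod_cast hρ.ne'
      have := (hG i j).2 (((ρ : ℂ) * w)⁻¹) ?_
      · convert this using 2
        field_simp
      · rw [norm_inv, norm_mul, Complex.norm_real, Real.norm_of_nonneg hρ.le]
        rw [mem_ball_zero_iff] at hw2
        have hpos : 0 < ρ * ‖w‖ := mul_pos hρ (norm_pos_iff.mpr hw0)
        rw [one_le_inv₀ hpos]
        calc ρ * ‖w‖ ≤ ρ * ρ⁻¹ := by gcongr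
          _ = 1 := mul_inv_cancel₀ hρ.ne'
    have := StateSpace.evalAt_transferMatrix S w⁻¹ hdet i j hden
    change RatFunc.eval (algebraMap ℝ ℂ) w⁻¹ (S.transferMatrix i j) = _ at this
    rw [hfg w hw0, this]
    change (S.C.map c * (w⁻¹ • (1 : Matrix (Fin N) (Fin N) ℂ) - A)⁻¹ * S.B.map c +
      S.D.map c) i j = c (S.D i j) + w * (S.C.map c * Ring.inverse (1 - w • A) * S.B.map c) i j
    rw [hinv, Matrix.nonsing_inv_eq_ringInverse]
    simp [add_comm]
  have hev0 : ∀ᶠ w in 𝓝 (0 : ℂ), f w = c (S.D i j) + w * h w := by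
    refine (hfan.frequently_eq_iff_eventually_eq ?_).mp hev.frequently
    exact analyticAt_const.add (analyticAt_id.mul hh.analyticAt)
  have hf0 : f 0 = c (S.D i j) := by simpa using hev0.self_of_nhds
  have hdiff : DifferentiableOn ℂ (dslope f 0) (Metric.ball 0 R) :=
    (Complex.differentiableOn_dslope (Metric.ball_mem_nhds _ hR0)).mpr hf
  have hds : ∀ᶠ w in 𝓝 (0 : ℂ), dslope f 0 w = h w := by
    have han : AnalyticAt ℂ (dslope f 0) 0 := hdiff.analyticAt (Metric.ball_mem_nhds _ hR0)
    refine (han.frequently_eq_iff_eventually_eq hh.analyticAt).mp (Eventually.frequently ?_)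
    filter_upwards [hev, self_mem_nhdsWithin] with w hw hw0
    replace hw0 : w ≠ 0 := hw0
    rw [dslope_of_ne _ hw0, slope_def_field, hw, hf0]
    field_simp
    ring
  obtain ⟨r, hr1, hr2⟩ := exists_between hR
  lift r to NNReal using (hρi.trans hr1).le
  have hr0 : 0 < r := by exact_mod_cast hρi.trans hr1
  have hball : HasFPowerSeriesOnBall (dslope f 0) (cauchyPowerSeries (dslope f 0) 0 r) 0 r :=
    (hdiff.mono (Metric.closedBall_subset_ball hr2)).hasFPowerSeriesOnBall hr0
  have hpeq : cauchyPowerSeries (dslope f 0) 0 r = ph :=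
    (hball.hasFPowerSeriesAt.congr hds).eq_formalMultilinearSeries hh
  rw [hpeq] at hball
  have hrad : ((Real.toNNReal ρ⁻¹ : NNReal) : ENNReal) < ph.radius := by
    refine lt_of_lt_of_le ?_ hball.r_le
    rw [ENNReal.coe_lt_coe, ← NNReal.coe_lt_coe, Real.coe_toNNReal _ hρi.le]
    exact hr1
  have hsum := ph.summable_norm_mul_pow hrad
  rw [Real.coe_toNNReal _ hρi.le] at hsum
  refine Summable.of_nonneg_of_le (fun k => by positivity) (fun k => ?_) hsum
  have hk := (ph k).le_opNorm (fun _ => 1)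
  have hval : ph k (fun _ => 1) = c ((S.C * S.A ^ k * S.B) i j) := by
    have hpow : A ^ k = (S.A ^ k).map c := (map_pow c.mapMatrix S.A k).symm
    have : ph k (fun _ => 1) = L (A ^ k) := by
      change L (ContinuousMultilinearMap.mkPiRing ℂ (Fin k) (A ^ k) fun _ => 1) = _
      simp
    rw [this]
    change (S.C.map c * A ^ k * S.B.map c) i j = _
    rw [hpow, ← Matrix.map_mul, ← Matrix.map_mul]
    rfl
  rw [hval] at hk
  have hn : ‖c ((S.C * S.A ^ k * S.B) i j)‖ = |(S.C * S.A ^ k * S.B) i j| := by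
    simp [c]
  rw [hn] at hk
  rw [mul_comm]
  refine mul_le_mul_of_nonneg_right ?_ (by positivity)
  simpa using hk

end Analytic

section Decay

variable {m n N : ℕ}

/-- Controllability and observability express the entries of `Aᵏ` as fixed finite combinations of
Markov parameters. -/
lemma summable_dotProduct_pow_mulVec {ρ : ℝ} (hρ : 0 < ρ) {S : StateSpace m n N}
    {G : Matrix (Fin m) (Fin n) (RatFunc ℝ)} (hS : S.IsMinimalRealization G)
    (hG : ScaledRHInf ρ G) (φ v : Fin N → ℝ) :
    Summable fun k : ℕ => ρ⁻¹ ^ k * |φ ⬝ᵥ (S.A ^ k).mulVec v| := by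
  have hv : v ∈ S.reachable := by rw [hS.reachable_eq_top]; trivial
  have hφ : φ ∈ S.dual.reachable := by rw [hS.dual.reachable_eq_top]; trivial
  rw [← hS.1] at hG
  have hρi : 0 < ρ⁻¹ := inv_pos.mpr hρ
  induction hφ using Submodule.span_induction with
  | zero => simp
  | add x y _ _ hx hy =>
    refine Summable.of_nonneg_of_le (fun k => by positivity) (fun k => ?_) (hx.add hy)
    rw [add_dotProduct, ← mul_add]
    gcongr
    exact abs_add_le _ _
  | smul a x _ hx =>
    refine (hx.mul_left |a|).congr fun k => ?_
    rw [smul_dotProduct, smul_eq_mul, abs_mul]; ring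
  | mem x hx =>
    obtain ⟨⟨p, i⟩, rfl⟩ := hx
    induction hv using Submodule.span_induction with
    | zero => simp
    | add x y _ _ hx hy =>
      refine Summable.of_nonneg_of_le (fun k => by positivity) (fun k => ?_) (hx.add hy)
      rw [Matrix.mulVec_add, dotProduct_add, ← mul_add]
      gcongr
      exact abs_add_le _ _
    | smul a x _ hx =>
      refine (hx.mul_left |a|).congr fun k => ?_
      rw [Matrix.mulVec_smul, dotProduct_smul, smul_eq_mul, abs_mul]; ring
    | mem x hx =>
      obtain ⟨⟨q, j⟩, rfl⟩ := hx
      have hs := (summable_nat_add_iff (p + q)).mpr (summable_markov hρ S hG i j)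
      refine (hs.mul_left (ρ ^ (p + q))).congr fun k => ?_
      have hval : (S.dual.A ^ p).mulVec (S.dual.B.col i) ⬝ᵥ
          (S.A ^ k).mulVec ((S.A ^ q).mulVec (S.B.col j)) =
          (S.C * S.A ^ (k + (p + q)) * S.B) i j := by
        have h1 : (S.dual.A ^ p).mulVec (S.dual.B.col i) =
            Matrix.vecMul (S.C.row i) (S.A ^ p) := by
          rw [StateSpace.dual, ← Matrix.transpose_pow, Matrix.mulVec_transpose]
          rfl
        rw [h1, ← Matrix.dotProduct_mulVec, Matrix.mulVec_mulVec, Matrix.mulVec_mulVec,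
          ← pow_add, ← pow_add, Matrix.dotProduct_mulVec, show p + k + q = k + (p + q) by ring]
        rfl
      simp only [hval]
      rw [pow_add ρ⁻¹, ← mul_assoc, inv_pow ρ (p + q)]
      field_simp

lemma norm_le_sum_abs (x : EuclideanSpace ℝ (Fin N)) : ‖x‖ ≤ ∑ i, |x i| := by
  conv_lhs => rw [← (EuclideanSpace.basisFun (Fin N) ℝ).sum_repr x]
  refine (norm_sum_le _ _).trans (le_of_eq ?_)
  simp [norm_smul]

lemma summable_norm_pow {ρ : ℝ} (hρ : 0 < ρ) {S : StateSpace m n N}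
    {G : Matrix (Fin m) (Fin n) (RatFunc ℝ)} (hS : S.IsMinimalRealization G)
    (hG : ScaledRHInf ρ G) (x : EuclideanSpace ℝ (Fin N)) :
    Summable fun k : ℕ => ρ⁻¹ ^ k * ‖(S.A ^ k).toEuclideanLin x‖ := by
  have hρi : 0 < ρ⁻¹ := inv_pos.mpr hρ
  have h := summable_sum (s := Finset.univ) fun (i : Fin N) _ =>
    summable_dotProduct_pow_mulVec hρ hS hG (Pi.single i 1) x.ofLp
  refine Summable.of_nonneg_of_le (fun k => by positivity) (fun k => ?_) h
  rw [← Finset.mul_sum]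
  gcongr
  refine (norm_le_sum_abs _).trans (le_of_eq ?_)
  simp only [single_one_dotProduct]
  rfl

end Decay


/-! ### Truncated energies -/

section Energy

variable {d : ℕ} {ρ : ℝ}

/-- The part `∑_{k < K} ρ^{-2k} |x_k|²` of the squared `ℓ₂^ρ` norm of `x` before time `K`. -/
noncomputable def energy (ρ : ℝ) (x : Signal d) (K : ℕ) : ℝ :=
  ∑ k ∈ Finset.range K, (ρ⁻¹ ^ k * ‖x k‖) ^ 2

lemma energy_nonneg (x : Signal d) (K : ℕ) : 0 ≤ energy ρ x K :=
  Finset.sum_nonneg fun _ _ => sq_nonneg _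

lemma energy_le_ell2NormSq {x : Signal d} (hx : MemEll2 ρ x) (K : ℕ) :
    energy ρ x K ≤ ell2NormSq ρ x :=
  Summable.sum_le_tsum _ (fun _ _ => sq_nonneg _) hx

lemma memEll2_of_energy_le {x : Signal d} {c : ℝ} (h : ∀ K, energy ρ x K ≤ c) : MemEll2 ρ x :=
  summable_of_sum_range_le (fun _ => sq_nonneg _) h

lemma ell2NormSq_le_of_energy_le {x : Signal d} {c : ℝ} (h : ∀ K, energy ρ x K ≤ c) :
    ell2NormSq ρ x ≤ c :=
  Real.tsum_le_of_sum_range_le (fun _ => sq_nonneg _) h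

lemma ell2NormSq_nonneg (x : Signal d) : 0 ≤ ell2NormSq ρ x :=
  tsum_nonneg fun _ => sq_nonneg _

lemma energy_congr {x y : Signal d} {K : ℕ} (h : ∀ k < K, x k = y k) :
    energy ρ x K = energy ρ y K :=
  Finset.sum_congr rfl fun k hk => by rw [h k (Finset.mem_range.mp hk)]

lemma energy_add_le (x y : Signal d) (K : ℕ) :
    energy ρ (x + y) K ≤ 2 * (energy ρ x K + energy ρ y K) := by
  unfold energy
  rw [← Finset.sum_add_distrib, Finset.mul_sum]
  refine Finset.sum_le_sum fun k _ => ?_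
  have h : ‖x k + y k‖ ^ 2 ≤ 2 * (‖x k‖ ^ 2 + ‖y k‖ ^ 2) :=
    (pow_le_pow_left₀ (norm_nonneg _) (norm_add_le _ _) 2).trans add_sq_le
  simp only [Pi.add_apply, mul_pow]
  nlinarith [sq_nonneg (ρ⁻¹ ^ k)]

lemma energy_smul (a : ℝ) (x : Signal d) (K : ℕ) :
    energy ρ (a • x) K = a ^ 2 * energy ρ x K := by
  unfold energy
  rw [Finset.mul_sum]
  refine Finset.sum_congr rfl fun k _ => ?_
  rw [Pi.smul_apply, norm_smul, mul_pow, mul_pow, mul_pow, Real.norm_eq_abs, sq_abs]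
  ring

lemma energy_map_le {d' : ℕ} (L : EuclideanSpace ℝ (Fin d) →ₗ[ℝ] EuclideanSpace ℝ (Fin d'))
    (x : Signal d) (K : ℕ) :
    energy ρ (fun k => L (x k)) K ≤ ‖L.toContinuousLinearMap‖ ^ 2 * energy ρ x K := by
  unfold energy
  rw [Finset.mul_sum]
  refine Finset.sum_le_sum fun k _ => ?_
  have h : ‖L (x k)‖ ^ 2 ≤ (‖L.toContinuousLinearMap‖ * ‖x k‖) ^ 2 :=
    pow_le_pow_left₀ (norm_nonneg _) (L.toContinuousLinearMap.le_opNorm (x k)) 2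
  rw [mul_pow] at h ⊢
  rw [mul_pow]
  nlinarith [sq_nonneg (ρ⁻¹ ^ k)]

lemma MemEll2.add {x y : Signal d} (hx : MemEll2 ρ x) (hy : MemEll2 ρ y) : MemEll2 ρ (x + y) :=
  memEll2_of_energy_le (c := 2 * (ell2NormSq ρ x + ell2NormSq ρ y)) fun K =>
    (energy_add_le x y K).trans (by
      linarith [energy_le_ell2NormSq hx K, energy_le_ell2NormSq hy K])

lemma MemEll2.map {d' : ℕ} {x : Signal d} (hx : MemEll2 ρ x)
    (L : EuclideanSpace ℝ (Fin d) →ₗ[ℝ] EuclideanSpace ℝ (Fin d')) :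
    MemEll2 ρ (fun k => L (x k)) :=
  memEll2_of_energy_le (c := ‖L.toContinuousLinearMap‖ ^ 2 * ell2NormSq ρ x) fun K =>
    (energy_map_le L x K).trans
      (mul_le_mul_of_nonneg_left (energy_le_ell2NormSq hx K) (sq_nonneg _))

/-- The signal `x` switched off from time `K` on. -/
def truncate (x : Signal d) (K : ℕ) : Signal d := fun k => if k < K then x k else 0

lemma truncate_of_lt (x : Signal d) {K k : ℕ} (h : k < K) : truncate x K k = x k := if_pos h

lemma energy_truncate_le (x : Signal d) (K M : ℕ) :
    energy ρ (truncate x K) M ≤ energy ρ x K := by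
  have h0 : ∀ k ∈ Finset.range M, k ∉ Finset.range K →
      (ρ⁻¹ ^ k * ‖truncate x K k‖) ^ 2 = 0 := by
    intro k _ hk
    have : ¬ k < K := by simpa using hk
    simp [truncate, this]
  unfold energy
  rw [← Finset.sum_filter_add_sum_filter_not (Finset.range M) (· ∈ Finset.range K),
    Finset.sum_eq_zero (s := Finset.filter _ _) (f := fun k => (ρ⁻¹ ^ k * ‖truncate x K k‖) ^ 2)
      (fun k hk => h0 k (Finset.mem_filter.mp hk).1 (Finset.mem_filter.mp hk).2), add_zero]
  refine (Finset.sum_le_sum_of_subset_of_nonneg (t := Finset.range K)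
    (fun k hk => (Finset.mem_filter.mp hk).2) fun _ _ _ => sq_nonneg _).trans (le_of_eq ?_)
  exact energy_congr fun k hk => truncate_of_lt x hk

lemma memEll2_truncate (x : Signal d) (K : ℕ) : MemEll2 ρ (truncate x K) :=
  memEll2_of_energy_le (energy_truncate_le x K)

lemma ell2NormSq_truncate_le (x : Signal d) (K : ℕ) :
    ell2NormSq ρ (truncate x K) ≤ energy ρ x K :=
  ell2NormSq_le_of_energy_le (energy_truncate_le x K)

end Energy

/-! ### State and output bounds -/

/-- A scalar recursion with contraction factor `q < 1` has finite `ℓ₂` gain. -/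
lemma sum_sq_le_of_recursion {a b : ℕ → ℝ} {q : ℝ} (hq0 : 0 ≤ q) (hq1 : q < 1)
    (ha : ∀ k, 0 ≤ a k) (h : ∀ k, a (k + 1) ≤ q * a k + b k) (K : ℕ) :
    ∑ k ∈ Finset.range (K + 1), a k ^ 2 ≤
      ((1 - q)⁻¹) ^ 2 * (a 0 ^ 2 + ∑ k ∈ Finset.range K, b k ^ 2) := by
  have hp : 0 < 1 - q := by linarith
  have hstep : ∀ k, a (k + 1) ^ 2 ≤ q * a k ^ 2 + (1 - q)⁻¹ * b k ^ 2 := by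
    intro k
    have h1 : a (k + 1) ^ 2 ≤ (q * a k + b k) ^ 2 := pow_le_pow_left₀ (ha _) (h k) 2
    refine h1.trans ?_
    -- convexity of the square, for the weights `q` and `1 - q` at `a k` and `b k / (1 - q)`
    have h2 : 0 ≤ q * (1 - q) * (a k - (1 - q)⁻¹ * b k) ^ 2 := by positivity
    have h3 : q * a k ^ 2 + (1 - q)⁻¹ * b k ^ 2 - (q * a k + b k) ^ 2 =
        q * (1 - q) * (a k - (1 - q)⁻¹ * b k) ^ 2 := by
      field_simp
      ring
    linarith
  have hsum : ∑ k ∈ Finset.range K, a (k + 1) ^ 2 ≤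
      q * ∑ k ∈ Finset.range K, a k ^ 2 + (1 - q)⁻¹ * ∑ k ∈ Finset.range K, b k ^ 2 := by
    rw [Finset.mul_sum, Finset.mul_sum, ← Finset.sum_add_distrib]
    exact Finset.sum_le_sum fun k _ => hstep k
  have h1 := Finset.sum_range_succ' (fun k => a k ^ 2) K
  have h2 := Finset.sum_range_succ (fun k => a k ^ 2) K
  have h3 : q * ∑ k ∈ Finset.range K, a k ^ 2 ≤ q * ∑ k ∈ Finset.range (K + 1), a k ^ 2 := by
    rw [h2]
    nlinarith [sq_nonneg (a K)]
  have hone : 1 ≤ (1 - q)⁻¹ := (one_le_inv₀ hp).mpr (by linarith)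
  set Sa := ∑ k ∈ Finset.range (K + 1), a k ^ 2
  set Sb := ∑ k ∈ Finset.range K, b k ^ 2
  have h4 : (1 - q) * Sa ≤ (1 - q)⁻¹ * (a 0 ^ 2 + Sb) := by
    nlinarith [sq_nonneg (a 0)]
  calc Sa = (1 - q)⁻¹ * ((1 - q) * Sa) := by rw [inv_mul_cancel_left₀ hp.ne']
    _ ≤ (1 - q)⁻¹ * ((1 - q)⁻¹ * (a 0 ^ 2 + Sb)) := by gcongr
    _ = _ := by ring

section StateBound

variable {m n N : ℕ}

/-- The Lyapunov norm `N(x) = ∑ₖ ρ^{-k} ‖Aᵏ x‖` is equivalent to the Euclidean norm, and `A`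
multiplies it by at most `ρ q` with `q < 1`, because `N(A x) = ρ (N(x) - ‖x‖)`. -/
lemma exists_lyapunov_norm {ρ : ℝ} (hρ : 0 < ρ) (A : Matrix (Fin N) (Fin N) ℝ)
    (hA : ∀ x, Summable fun k : ℕ => ρ⁻¹ ^ k * ‖(A ^ k).toEuclideanLin x‖) :
    ∃ (V : EuclideanSpace ℝ (Fin N) → ℝ) (c q : ℝ), 0 ≤ c ∧ 0 ≤ q ∧ q < 1 ∧
      (∀ x, ‖x‖ ≤ V x) ∧ (∀ x, V x ≤ c * ‖x‖) ∧ (∀ x y, V (x + y) ≤ V x + V y) ∧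
      ∀ x, V (A.toEuclideanLin x) ≤ ρ * q * V x := by
  have hρi : 0 < ρ⁻¹ := inv_pos.mpr hρ
  let V : EuclideanSpace ℝ (Fin N) → ℝ := fun x => ∑' k : ℕ, ρ⁻¹ ^ k * ‖(A ^ k).toEuclideanLin x‖
  have hV0 : ∀ x, 0 ≤ V x := fun x => tsum_nonneg fun k => by positivity
  have hadd : ∀ x y, V (x + y) ≤ V x + V y := by
    intro x y
    rw [← (hA x).tsum_add (hA y)]
    refine (hA _).tsum_le_tsum (fun k => ?_) ((hA x).add (hA y))
    rw [map_add, ← mul_add]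
    gcongr
    exact norm_add_le _ _
  have hsmul : ∀ (a : ℝ) x, V (a • x) = |a| * V x := by
    intro a x
    rw [← tsum_mul_left]
    refine tsum_congr fun k => ?_
    rw [map_smul, norm_smul, Real.norm_eq_abs]; ring
  have hV00 : V 0 = 0 := by simpa using hsmul 0 0
  let e := EuclideanSpace.basisFun (Fin N) ℝ
  let c := 1 + ∑ i, V (e i)
  have hc : 1 ≤ c := le_add_of_nonneg_right (Finset.sum_nonneg fun i _ => hV0 _)
  have hc0 : 0 < c := by linarith
  have hle : ∀ x, V x ≤ c * ‖x‖ := by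
    intro x
    have h1 : V x ≤ ∑ i, |x i| * V (e i) := by
      conv_lhs => rw [← e.sum_repr x]
      refine (Finset.le_sum_of_subadditive V hV00.le hadd _ _).trans (le_of_eq ?_)
      refine Finset.sum_congr rfl fun i _ => ?_
      rw [hsmul]
      simp [e]
    refine h1.trans ?_
    calc ∑ i, |x i| * V (e i) ≤ ∑ i, ‖x‖ * V (e i) := by
          refine Finset.sum_le_sum fun i _ => ?_
          exact mul_le_mul_of_nonneg_right (PiLp.norm_apply_le x i) (hV0 _)
      _ = ‖x‖ * ∑ i, V (e i) := by rw [Finset.mul_sum]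
      _ ≤ c * ‖x‖ := by nlinarith [norm_nonneg x]
  have hrec : ∀ x, V x = ‖x‖ + ρ⁻¹ * V (A.toEuclideanLin x) := by
    intro x
    have h := (hA x).tsum_eq_zero_add
    have hAk : ∀ k, (A ^ (k + 1)).toEuclideanLin x =
        (A ^ k).toEuclideanLin (A.toEuclideanLin x) := by
      intro k
      ext i
      simp [pow_succ]
    change V x = _ at h
    rw [h, ← tsum_mul_left]
    congr 1
    · simp
    · refine tsum_congr fun k => ?_
      rw [hAk, pow_succ]; ring
  refine ⟨V, c, 1 - c⁻¹, hc0.le, ?_, ?_, ?_, hle, hadd, ?_⟩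
  · have := inv_le_one_of_one_le₀ hc
    linarith
  · have := inv_pos.mpr hc0
    linarith
  · intro x
    rw [hrec x]
    have := mul_nonneg hρi.le (hV0 (A.toEuclideanLin x))
    linarith
  · intro x
    have h1 : c⁻¹ * V x ≤ ‖x‖ := by
      rw [inv_mul_le_iff₀ hc0]
      exact hle x
    have h2 : V (A.toEuclideanLin x) = ρ * (V x - ‖x‖) := by
      rw [hrec x]
      field_simp
      ring
    rw [h2, mul_assoc]
    refine mul_le_mul_of_nonneg_left ?_ hρ.le
    linarith

lemma exists_energy_stateSeq_le {ρ : ℝ} (hρ : 0 < ρ) (S : StateSpace m n N)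
    (hA : ∀ x, Summable fun k : ℕ => ρ⁻¹ ^ k * ‖(S.A ^ k).toEuclideanLin x‖) :
    ∃ c : ℝ, 0 ≤ c ∧ ∀ x₀ u K,
      energy ρ (S.stateSeq x₀ u) (K + 1) ≤ c * (‖x₀‖ ^ 2 + energy ρ u K) := by
  obtain ⟨V, c, q, hc, hq0, hq1, hV1, hV2, hadd, hVA⟩ := exists_lyapunov_norm hρ S.A hA
  have hρi : 0 < ρ⁻¹ := inv_pos.mpr hρ
  have hV0 : ∀ x, 0 ≤ V x := fun x => (norm_nonneg x).trans (hV1 x)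
  set β := ‖S.B.toEuclideanLin.toContinuousLinearMap‖
  have hβ : 0 ≤ β := norm_nonneg _
  set κ := ρ⁻¹ * (c * β)
  refine ⟨((1 - q)⁻¹) ^ 2 * (c ^ 2 + κ ^ 2), by positivity, fun x₀ u K => ?_⟩
  have hrec : ∀ k, ρ⁻¹ ^ (k + 1) * V (S.stateSeq x₀ u (k + 1)) ≤
      q * (ρ⁻¹ ^ k * V (S.stateSeq x₀ u k)) + κ * (ρ⁻¹ ^ k * ‖u k‖) := by
    intro k
    have h1 : V (S.stateSeq x₀ u (k + 1)) ≤ ρ * q * V (S.stateSeq x₀ u k) + c * (β * ‖u k‖) := by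
      refine (hadd _ _).trans (add_le_add (hVA _) ((hV2 _).trans ?_))
      exact mul_le_mul_of_nonneg_left
        (S.B.toEuclideanLin.toContinuousLinearMap.le_opNorm (u k)) hc
    calc ρ⁻¹ ^ (k + 1) * V (S.stateSeq x₀ u (k + 1))
        ≤ ρ⁻¹ ^ (k + 1) * (ρ * q * V (S.stateSeq x₀ u k) + c * (β * ‖u k‖)) := by gcongr
      _ = (ρ⁻¹ * ρ) * (q * (ρ⁻¹ ^ k * V (S.stateSeq x₀ u k))) + κ * (ρ⁻¹ ^ k * ‖u k‖) := by
          simp only [κ, pow_succ]; ring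
      _ = _ := by rw [inv_mul_cancel₀ hρ.ne', one_mul]
  have h := sum_sq_le_of_recursion hq0 hq1
    (a := fun k => ρ⁻¹ ^ k * V (S.stateSeq x₀ u k)) (b := fun k => κ * (ρ⁻¹ ^ k * ‖u k‖))
    (fun k => mul_nonneg (by positivity) (hV0 _)) hrec K
  have h1 : energy ρ (S.stateSeq x₀ u) (K + 1) ≤
      ∑ k ∈ Finset.range (K + 1), (ρ⁻¹ ^ k * V (S.stateSeq x₀ u k)) ^ 2 := by
    refine Finset.sum_le_sum fun k _ => ?_
    gcongr
    exact hV1 _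
  have h2 : (ρ⁻¹ ^ 0 * V (S.stateSeq x₀ u 0)) ^ 2 ≤ c ^ 2 * ‖x₀‖ ^ 2 := by
    rw [pow_zero, one_mul, ← mul_pow]
    exact pow_le_pow_left₀ (hV0 _) (hV2 _) 2
  have h3 : ∑ k ∈ Finset.range K, (κ * (ρ⁻¹ ^ k * ‖u k‖)) ^ 2 = κ ^ 2 * energy ρ u K := by
    simp only [energy, Finset.mul_sum, mul_pow]
  rw [h3] at h
  refine (h1.trans h).trans ?_
  rw [mul_assoc]
  gcongr
  nlinarith [sq_nonneg ‖x₀‖, sq_nonneg c, sq_nonneg κ, energy_nonneg (ρ := ρ) u K]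

lemma exists_energy_output_le {ρ : ℝ} (hρ : 0 < ρ) (S : StateSpace m n N)
    (hA : ∀ x, Summable fun k : ℕ => ρ⁻¹ ^ k * ‖(S.A ^ k).toEuclideanLin x‖) :
    ∃ c : ℝ, 0 ≤ c ∧ ∀ x₀ u K, energy ρ (S.output x₀ u) K ≤ c * (‖x₀‖ ^ 2 + energy ρ u K) := by
  obtain ⟨c, hc, h⟩ := exists_energy_stateSeq_le hρ S hA
  set α := ‖S.C.toEuclideanLin.toContinuousLinearMap‖ ^ 2
  set δ := ‖S.D.toEuclideanLin.toContinuousLinearMap‖ ^ 2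
  have hα : 0 ≤ α := sq_nonneg _
  have hδ : 0 ≤ δ := sq_nonneg _
  refine ⟨2 * (α * c + δ), by positivity, fun x₀ u K => ?_⟩
  have h1 : energy ρ (S.output x₀ u) K ≤ 2 * (α * energy ρ (S.stateSeq x₀ u) K +
      δ * energy ρ u K) := by
    refine (energy_add_le (fun k => S.C.toEuclideanLin (S.stateSeq x₀ u k))
      (fun k => S.D.toEuclideanLin (u k)) K).trans ?_
    gcongr
    · exact energy_map_le _ _ _
    · exact energy_map_le _ _ _
  have h2 : energy ρ (S.stateSeq x₀ u) K ≤ c * (‖x₀‖ ^ 2 + energy ρ u K) := by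
    refine le_trans ?_ (h x₀ u K)
    rw [energy, energy, Finset.sum_range_succ]
    exact le_add_of_nonneg_right (sq_nonneg _)
  have h3 := mul_le_mul_of_nonneg_left h2 hα
  nlinarith [mul_nonneg hδ (sq_nonneg ‖x₀‖)]

namespace StateSpace

lemma stateSeq_add (S : StateSpace m n N) (x₀ x₁ : EuclideanSpace ℝ (Fin N)) (u v : Signal n) :
    S.stateSeq (x₀ + x₁) (u + v) = S.stateSeq x₀ u + S.stateSeq x₁ v := by
  funext k
  induction k with
  | zero => rfl
  | succ k ih =>
    simp only [stateSeq, Pi.add_apply] at ih ⊢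
    rw [ih, map_add, map_add]
    abel

lemma output_add (S : StateSpace m n N) (x₀ x₁ : EuclideanSpace ℝ (Fin N)) (u v : Signal n) :
    S.output (x₀ + x₁) (u + v) = S.output x₀ u + S.output x₁ v := by
  funext k
  simp only [output, stateSeq_add, Pi.add_apply, map_add]
  abel

lemma stateSeq_zero_smul (S : StateSpace m n N) (a : ℝ) (u : Signal n) :
    S.stateSeq 0 (a • u) = a • S.stateSeq 0 u := by
  funext k
  induction k with
  | zero => simp [stateSeq]
  | succ k ih =>
    simp only [stateSeq, Pi.smul_apply] at ih ⊢
    rw [ih, map_smul, map_smul, smul_add]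

lemma output_zero_smul (S : StateSpace m n N) (a : ℝ) (u : Signal n) :
    S.output 0 (a • u) = a • S.output 0 u := by
  funext k
  simp only [output, stateSeq_zero_smul, Pi.smul_apply, map_smul, smul_add]

/-- The response splits into the free response to the initial state and the forced response. -/
lemma output_eq_add (S : StateSpace m n N) (x₀ : EuclideanSpace ℝ (Fin N)) (u : Signal n) :
    S.output x₀ u = S.output 0 u + S.output x₀ 0 := by
  rw [← output_add, zero_add, add_zero]

end StateSpace

end StateBound


/-! ### The transform on the circle -/

section Transform

variable {d : ℕ} {ρ : ℝ}

lemma MemEll2.summable_coord {x : Signal d} (hx : MemEll2 ρ x) (i : Fin d) :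
    Summable fun k : ℕ => (ρ⁻¹ ^ k * x k i) ^ 2 := by
  refine Summable.of_nonneg_of_le (fun k => sq_nonneg _) (fun k => ?_) hx
  rw [mul_pow, mul_pow]
  refine mul_le_mul_of_nonneg_left ?_ (sq_nonneg _)
  rw [← sq_abs (x k i)]
  exact pow_le_pow_left₀ (abs_nonneg _) (PiLp.norm_apply_le (x k) i) 2

lemma orthonormal_fourierLp_neg :
    Orthonormal ℂ fun k : ℕ => (fourierLp 2 (-(k : ℤ)) : Lp ℂ 2 (haarAddCircle (T := (1 : ℝ)))) :=
  orthonormal_fourier.comp (fun k : ℕ => -(k : ℤ)) fun a b h => by simpa using h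

lemma hasSum_zTransform {x : Signal d} (hx : MemEll2 ρ x) (i : Fin d) :
    HasSum (fun k : ℕ => ((ρ⁻¹ ^ k * x k i : ℝ) : ℂ) •
      (fourierLp 2 (-(k : ℤ)) : Lp ℂ 2 (haarAddCircle (T := (1 : ℝ))))) (zTransform ρ x i) := by
  have h := (orthonormal_fourierLp_neg.orthogonalFamily.summable_iff_norm_sq_summable
    fun k : ℕ => ((ρ⁻¹ ^ k * x k i : ℝ) : ℂ)).mpr ?_
  · exact h.hasSum
  · simpa only [Complex.norm_real, Real.norm_eq_abs, sq_abs] using hx.summable_coord i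

lemma norm_zTransform_sq {x : Signal d} (hx : MemEll2 ρ x) (i : Fin d) :
    ‖zTransform ρ x i‖ ^ 2 = ∑' k : ℕ, (ρ⁻¹ ^ k * x k i) ^ 2 := by
  have h1 := ((hasSum_zTransform hx i).norm.pow 2 :
    Filter.Tendsto _ _ (nhds (‖zTransform ρ x i‖ ^ 2)))
  refine tendsto_nhds_unique h1 ?_
  refine (hx.summable_coord i).hasSum.congr fun s => ?_
  have := orthonormal_fourierLp_neg.orthogonalFamily.norm_sum
    (fun k : ℕ => ((ρ⁻¹ ^ k * x k i : ℝ) : ℂ)) s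
  simp only [Complex.norm_real, Real.norm_eq_abs, sq_abs] at this
  exact this.symm

/-- The pointwise squared length `|x̂(ρz)|²`. -/
noncomputable def transformSq (ρ : ℝ) (x : Signal d) (t : UnitAddCircle) : ℝ :=
  ∑ i, ‖zTransform ρ x i t‖ ^ 2

lemma integrable_norm_sq (f : Lp ℂ 2 (haarAddCircle (T := (1 : ℝ)))) :
    Integrable (fun t => ‖f t‖ ^ 2) haarAddCircle :=
  (Lp.memLp f).integrable_norm_pow (by norm_num)

lemma integrable_transformSq (x : Signal d) :
    Integrable (transformSq ρ x) haarAddCircle :=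
  integrable_finsetSum _ fun _ _ => integrable_norm_sq _

/-- Parseval's identity. -/
lemma integral_transformSq {x : Signal d} (hx : MemEll2 ρ x) :
    ∫ t, transformSq ρ x t ∂haarAddCircle = ell2NormSq ρ x := by
  unfold transformSq
  rw [integral_finsetSum _ fun i _ => integrable_norm_sq _]
  have h : ∀ i, ∫ t, ‖zTransform ρ x i t‖ ^ 2 ∂haarAddCircle = ∑' k : ℕ, (ρ⁻¹ ^ k * x k i) ^ 2 := by
    intro i
    rw [← norm_zTransform_sq hx i]
    have h1 := L2.inner_def (𝕜 := ℂ) (zTransform ρ x i) (zTransform ρ x i)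
    rw [inner_self_eq_norm_sq_to_K] at h1
    simp only [inner_self_eq_norm_sq_to_K] at h1
    have h2 : ((‖zTransform ρ x i‖ ^ 2 : ℝ) : ℂ) =
        ((∫ t, ‖zTransform ρ x i t‖ ^ 2 ∂haarAddCircle : ℝ) : ℂ) := by
      rw [← integral_complex_ofReal]
      push_cast
      exact h1
    exact_mod_cast h2.symm
  simp_rw [h]
  rw [← Summable.tsum_finsetSum fun i _ => hx.summable_coord i]
  refine tsum_congr fun k => ?_
  rw [mul_pow, EuclideanSpace.norm_sq_eq, Finset.mul_sum]
  refine Finset.sum_congr rfl fun i _ => ?_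
  rw [mul_pow, Real.norm_eq_abs, sq_abs]

lemma zTransform_add {x y : Signal d} (hx : MemEll2 ρ x) (hy : MemEll2 ρ y) (i : Fin d) :
    zTransform ρ (x + y) i = zTransform ρ x i + zTransform ρ y i := by
  refine ((hasSum_zTransform hx i).add (hasSum_zTransform hy i)).tsum_eq ▸ ?_
  refine tsum_congr fun k => ?_
  rw [← add_smul]
  congr 1
  simp [mul_add]

lemma zTransform_map {d' : ℕ} {x : Signal d} (hx : MemEll2 ρ x)
    (M : Matrix (Fin d') (Fin d) ℝ) (i : Fin d') :
    zTransform ρ (fun k => M.toEuclideanLin (x k)) i = ∑ j, (M i j : ℂ) • zTransform ρ x j := by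
  refine (hasSum_sum fun j (_ : j ∈ Finset.univ) =>
    (hasSum_zTransform hx j).const_smul (M i j : ℂ)).tsum_eq ▸ ?_
  refine tsum_congr fun k => ?_
  simp only [smul_smul]
  rw [← Finset.sum_smul]
  congr 1
  simp only [Matrix.toEuclideanLin, Matrix.toLpLin_apply, Matrix.mulVec, dotProduct, Finset.mul_sum]
  push_cast
  exact Finset.sum_congr rfl fun j _ => by ring

lemma coeFn_sum_smul {ι : Type*} (s : Finset ι) (a : ι → ℂ)
    (f : ι → Lp ℂ 2 (haarAddCircle (T := (1 : ℝ)))) :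
    ∀ᵐ t ∂haarAddCircle, (∑ j ∈ s, a j • f j : Lp ℂ 2 haarAddCircle) t = ∑ j ∈ s, a j * f j t := by
  classical
  induction s using Finset.induction_on with
  | empty => simp
  | insert j s hj ih =>
    rw [Finset.sum_insert hj]
    filter_upwards [ih, Lp.coeFn_add (a j • f j) (∑ j ∈ s, a j • f j),
      Lp.coeFn_smul (a j) (f j)] with t h1 h2 h3
    rw [h2, Pi.add_apply, h1, h3, Finset.sum_insert hj, Pi.smul_apply, smul_eq_mul]

lemma zTransform_map_ae {d' : ℕ} {x : Signal d} (hx : MemEll2 ρ x)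
    (M : Matrix (Fin d') (Fin d) ℝ) :
    ∀ᵐ t ∂haarAddCircle, (fun i => zTransform ρ (fun k => M.toEuclideanLin (x k)) i t) =
      (M.map (algebraMap ℝ ℂ)).mulVec fun j => zTransform ρ x j t := by
  have h : ∀ᵐ t ∂haarAddCircle, ∀ i, (∑ j, (M i j : ℂ) • zTransform ρ x j :
      Lp ℂ 2 (haarAddCircle (T := (1 : ℝ)))) t = ∑ j, (M i j : ℂ) * zTransform ρ x j t :=
    ae_all_iff.mpr fun i => coeFn_sum_smul _ _ _
  filter_upwards [h] with t ht
  funext i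
  rw [zTransform_map hx, ht]
  rfl

lemma zTransform_add_ae {x y : Signal d} (hx : MemEll2 ρ x) (hy : MemEll2 ρ y) :
    ∀ᵐ t ∂haarAddCircle, (fun i => zTransform ρ (x + y) i t) =
      (fun i => zTransform ρ x i t) + fun i => zTransform ρ y i t := by
  have h : ∀ᵐ t ∂haarAddCircle, ∀ i, (zTransform ρ x i + zTransform ρ y i :
      Lp ℂ 2 (haarAddCircle (T := (1 : ℝ)))) t = zTransform ρ x i t + zTransform ρ y i t :=
    ae_all_iff.mpr fun i => Lp.coeFn_add _ _
  filter_upwards [h] with t ht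
  funext i
  rw [zTransform_add hx hy, ht]
  rfl

/-- Multiplication by `z` on `L²` of the circle. -/
noncomputable def mulZ : Lp ℂ 2 (haarAddCircle (T := (1 : ℝ))) →L[ℂ]
    Lp ℂ 2 (haarAddCircle (T := (1 : ℝ))) :=
  (ContinuousLinearMap.mul ℂ ℂ).holderL haarAddCircle ∞ 2 2 (fourierLp ∞ 1)

lemma mulZ_ae (f : Lp ℂ 2 (haarAddCircle (T := (1 : ℝ)))) :
    ∀ᵐ t ∂haarAddCircle, mulZ f t = circlePt t * f t := by
  have h1 := ContinuousLinearMap.coeFn_holder (r := 2) (ContinuousLinearMap.mul ℂ ℂ)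
    (fourierLp ∞ 1 : Lp ℂ ∞ (haarAddCircle (T := (1 : ℝ)))) f
  filter_upwards [h1, coeFn_fourierLp (T := (1 : ℝ)) ∞ 1] with t h1 h2
  refine h1.trans ?_
  rw [h2, fourier_one]
  rfl

lemma mulZ_fourierLp (k : ℤ) : mulZ (fourierLp 2 k) = fourierLp 2 (k + 1) := by
  refine Lp.ext ?_
  filter_upwards [mulZ_ae (fourierLp 2 k), coeFn_fourierLp (T := (1 : ℝ)) 2 k,
    coeFn_fourierLp (T := (1 : ℝ)) 2 (k + 1)] with t h1 h2 h3
  rw [h1, h2, h3, fourier_add, fourier_one, mul_comm]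
  rfl

/-- Advancing a signal that starts at `0` multiplies its transform by `ρz`. -/
lemma zTransform_shift_ae (hρ : 0 < ρ) {x : Signal d} (hx : MemEll2 ρ x) (hx0 : x 0 = 0) :
    ∀ᵐ t ∂haarAddCircle, (fun i => zTransform ρ (fun k => x (k + 1)) i t) =
      ((ρ : ℂ) * circlePt t) • fun i => zTransform ρ x i t := by
  have hρ' : (ρ : ℂ) ≠ 0 := by exact_mod_cast hρ.ne'
  have hz : ∀ i, zTransform ρ (fun k => x (k + 1)) i = (ρ : ℂ) • mulZ (zTransform ρ x i) := by
    intro i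
    have h1 := (hasSum_nat_add_iff' 1).mpr (hasSum_zTransform hx i)
    rw [Finset.sum_range_one, hx0, PiLp.zero_apply, mul_zero, Complex.ofReal_zero, zero_smul,
      sub_zero] at h1
    have h2 := ((mulZ.hasSum h1).const_smul (ρ : ℂ)).tsum_eq
    rw [← h2]
    refine tsum_congr fun k => ?_
    rw [map_smul, mulZ_fourierLp, smul_smul]
    congr 1
    · push_cast
      rw [pow_succ]
      field_simp
    · congr 1
      push_cast
      ring
  have h : ∀ᵐ t ∂haarAddCircle, ∀ i, ((ρ : ℂ) • mulZ (zTransform ρ x i) :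
      Lp ℂ 2 (haarAddCircle (T := (1 : ℝ)))) t = (ρ : ℂ) * (circlePt t * zTransform ρ x i t) := by
    refine ae_all_iff.mpr fun i => ?_
    filter_upwards [Lp.coeFn_smul (ρ : ℂ) (mulZ (zTransform ρ x i)),
      mulZ_ae (zTransform ρ x i)] with t h1 h2
    rw [h1, Pi.smul_apply, h2, smul_eq_mul]
  filter_upwards [h] with t ht
  funext i
  rw [hz, ht, Pi.smul_apply, smul_eq_mul, mul_assoc]

end Transform

section Transfer

variable {m n N : ℕ} {ρ : ℝ}

/-- An eigenvalue `λ` of `A` with `|λ| = ρ` would keep `ρ^{-k} ‖Aᵏ v‖` constant on an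
eigenvector `v`. -/
lemma det_sub_ne_zero_of_summable (hρ : 0 < ρ) (A : Matrix (Fin N) (Fin N) ℝ)
    (hA : ∀ x, Summable fun k : ℕ => ρ⁻¹ ^ k * ‖(A ^ k).toEuclideanLin x‖) {z : ℂ}
    (hz : ‖z‖ = 1) :
    (((ρ : ℂ) * z) • (1 : Matrix (Fin N) (Fin N) ℂ) - A.map (algebraMap ℝ ℂ)).det ≠ 0 := by
  intro hdet
  obtain ⟨v, hv0, hv⟩ := Matrix.exists_mulVec_eq_zero_iff.mpr hdet
  apply hv0
  set l := (ρ : ℂ) * z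
  rw [Matrix.sub_mulVec, Matrix.smul_mulVec, Matrix.one_mulVec, sub_eq_zero] at hv
  have hpow : ∀ k : ℕ, ((A ^ k).map (algebraMap ℝ ℂ)).mulVec v = l ^ k • v := by
    intro k
    have hk : (A ^ k).map (algebraMap ℝ ℂ) = (A.map (algebraMap ℝ ℂ)) ^ k :=
      map_pow (algebraMap ℝ ℂ).mapMatrix A k
    rw [hk]
    induction k with
    | zero => simp
    | succ k ih =>
      rw [pow_succ, ← Matrix.mulVec_mulVec, ← hv, Matrix.mulVec_smul, ih, smul_smul,
        pow_succ, mul_comm]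
      exact map_pow (algebraMap ℝ ℂ).mapMatrix A k
  funext i
  have hsum := summable_sum (s := Finset.univ) fun (j : Fin N) _ =>
    (hA (EuclideanSpace.single j 1)).mul_right ‖v j‖
  have hconst : Summable fun _ : ℕ => ‖v i‖ := by
    refine Summable.of_nonneg_of_le (fun _ => norm_nonneg _) (fun k => ?_) hsum
    have hl : ‖l ^ k • v i‖ = ρ ^ k * ‖v i‖ := by
      rw [norm_smul, norm_pow, norm_mul, hz, mul_one, Complex.norm_real, Real.norm_of_nonneg hρ.le]
    have h1 : ρ ^ k * ‖v i‖ ≤ ∑ j, ‖(A ^ k).toEuclideanLin (EuclideanSpace.single j 1)‖ * ‖v j‖ := by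
      rw [← hl, ← Pi.smul_apply, ← hpow k]
      change ‖∑ j, (A ^ k).map (algebraMap ℝ ℂ) i j * v j‖ ≤ _
      refine (norm_sum_le _ _).trans (Finset.sum_le_sum fun j _ => ?_)
      rw [norm_mul]
      gcongr
      have h2 := PiLp.norm_apply_le ((A ^ k).toEuclideanLin (EuclideanSpace.single j 1)) i
      have h3 : ((A ^ k).toEuclideanLin (EuclideanSpace.single j 1)) i = (A ^ k) i j := by
        change (A ^ k).mulVec (Pi.single j 1) i = _
        simp
      rw [h3] at h2
      simpa using h2
    calc ‖v i‖ = ρ⁻¹ ^ k * (ρ ^ k * ‖v i‖) := by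
          rw [← mul_assoc, ← mul_pow, inv_mul_cancel₀ hρ.ne', one_pow, one_mul]
      _ ≤ ρ⁻¹ ^ k * ∑ j, ‖(A ^ k).toEuclideanLin (EuclideanSpace.single j 1)‖ * ‖v j‖ := by
          gcongr
      _ = _ := by
          rw [Finset.mul_sum]
          exact Finset.sum_congr rfl fun j _ => (mul_assoc _ _ _).symm
  exact norm_eq_zero.mp (tendsto_nhds_unique tendsto_const_nhds hconst.tendsto_atTop_zero)

lemma norm_circlePt (t : UnitAddCircle) : ‖circlePt t‖ = 1 := Circle.norm_coe _

lemma memEll2_stateSeq (hρ : 0 < ρ) (S : StateSpace m n N)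
    (hA : ∀ x, Summable fun k : ℕ => ρ⁻¹ ^ k * ‖(S.A ^ k).toEuclideanLin x‖)
    (x₀ : EuclideanSpace ℝ (Fin N)) {u : Signal n} (hu : MemEll2 ρ u) :
    MemEll2 ρ (S.stateSeq x₀ u) := by
  obtain ⟨c, hc, h⟩ := exists_energy_stateSeq_le hρ S hA
  refine memEll2_of_energy_le (c := c * (‖x₀‖ ^ 2 + ell2NormSq ρ u)) fun K => ?_
  have h1 : energy ρ (S.stateSeq x₀ u) K ≤ energy ρ (S.stateSeq x₀ u) (K + 1) := by
    rw [energy, energy, Finset.sum_range_succ]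
    exact le_add_of_nonneg_right (sq_nonneg _)
  refine (h1.trans (h x₀ u K)).trans ?_
  gcongr
  exact energy_le_ell2NormSq hu K

lemma memEll2_output (hρ : 0 < ρ) (S : StateSpace m n N)
    (hA : ∀ x, Summable fun k : ℕ => ρ⁻¹ ^ k * ‖(S.A ^ k).toEuclideanLin x‖)
    (x₀ : EuclideanSpace ℝ (Fin N)) {u : Signal n} (hu : MemEll2 ρ u) :
    MemEll2 ρ (S.output x₀ u) :=
  ((memEll2_stateSeq hρ S hA x₀ hu).map S.C.toEuclideanLin).add (hu.map S.D.toEuclideanLin)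

/-- On the circle of radius `ρ`, the zero-state response is multiplication by the transfer
matrix: the transform turns the state equation into `(ρz I - A) x̂ = B û`. -/
lemma zTransform_output_ae (hρ : 0 < ρ) (S : StateSpace m n N)
    (hG : ScaledRHInf ρ S.transferMatrix)
    (hA : ∀ x, Summable fun k : ℕ => ρ⁻¹ ^ k * ‖(S.A ^ k).toEuclideanLin x‖)
    {u : Signal n} (hu : MemEll2 ρ u) :
    ∀ᵐ t ∂haarAddCircle, (fun i => zTransform ρ (S.output 0 u) i t) =
      (evalAt S.transferMatrix ((ρ : ℂ) * circlePt t)).mulVec fun j => zTransform ρ u j t := by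
  set x := S.stateSeq 0 u with hxdef
  have hx : MemEll2 ρ x := memEll2_stateSeq hρ S hA 0 hu
  have hshift := zTransform_shift_ae hρ hx rfl
  have hstate := zTransform_add_ae (hx.map S.A.toEuclideanLin) (hu.map S.B.toEuclideanLin)
  have hout := zTransform_add_ae (hx.map S.C.toEuclideanLin) (hu.map S.D.toEuclideanLin)
  filter_upwards [hshift, hstate, hout, zTransform_map_ae hx S.A, zTransform_map_ae hu S.B,
    zTransform_map_ae hx S.C, zTransform_map_ae hu S.D] with t h1 h2 h3 hAt hBt hCt hDt
  have hz := norm_circlePt t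
  set X := fun i => zTransform ρ x i t
  set U := fun j => zTransform ρ u j t
  set l := (ρ : ℂ) * circlePt t
  have hdet := det_sub_ne_zero_of_summable hρ S.A hA hz
  have hev : evalAt S.transferMatrix l =
      S.C.map (algebraMap ℝ ℂ) * (l • (1 : Matrix (Fin N) (Fin N) ℂ) -
        S.A.map (algebraMap ℝ ℂ))⁻¹ * S.B.map (algebraMap ℝ ℂ) + S.D.map (algebraMap ℝ ℂ) := by
    ext i j
    exact StateSpace.evalAt_transferMatrix S l hdet i j ((hG i j).2 _ hz.ge)
  have h12 : l • X = (S.A.map (algebraMap ℝ ℂ)).mulVec X + (S.B.map (algebraMap ℝ ℂ)).mulVec U := by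
    rw [← h1, ← hAt, ← hBt, ← h2]
    rfl
  have hX : X = (l • (1 : Matrix (Fin N) (Fin N) ℂ) - S.A.map (algebraMap ℝ ℂ))⁻¹.mulVec
      ((S.B.map (algebraMap ℝ ℂ)).mulVec U) := by
    have h4 : (l • (1 : Matrix (Fin N) (Fin N) ℂ) - S.A.map (algebraMap ℝ ℂ)).mulVec X =
        (S.B.map (algebraMap ℝ ℂ)).mulVec U := by
      rw [Matrix.sub_mulVec, Matrix.smul_mulVec, Matrix.one_mulVec, h12, add_sub_cancel_left]
    rw [← h4, Matrix.mulVec_mulVec, Matrix.nonsing_inv_mul _ (isUnit_iff_ne_zero.mpr hdet),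
      Matrix.one_mulVec]
  calc (fun i => zTransform ρ (S.output 0 u) i t)
      = (S.C.map (algebraMap ℝ ℂ)).mulVec X + (S.D.map (algebraMap ℝ ℂ)).mulVec U := by
        rw [← hCt, ← hDt, ← h3]
        rfl
    _ = _ := by
        rw [hev, Matrix.add_mulVec, ← Matrix.mulVec_mulVec, ← Matrix.mulVec_mulVec, ← hX]

end Transfer


/-! ### The integral quadratic constraint bounds the loop -/

section Form

variable {ι : Type*} [Fintype ι]

lemma norm_star_dotProduct_mulVec_le {M θ : ℝ} (hM : 0 ≤ M) (hθ : 0 < θ) {Q : Matrix ι ι ℂ}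
    (hQ : ∀ i j, ‖Q i j‖ ≤ M) (a b : ι → ℂ) :
    ‖star a ⬝ᵥ Q.mulVec b‖ ≤
      M * Fintype.card ι * (θ * ∑ i, ‖a i‖ ^ 2 + θ⁻¹ * ∑ i, ‖b i‖ ^ 2) := by
  have hcs : ∀ c : ι → ℂ, (∑ i, ‖c i‖) ^ 2 ≤ Fintype.card ι * ∑ i, ‖c i‖ ^ 2 := fun c => by
    simpa using sq_sum_le_card_mul_sum_sq (s := Finset.univ) (f := fun i => ‖c i‖)
  have h1 : ‖star a ⬝ᵥ Q.mulVec b‖ ≤ M * ((∑ i, ‖a i‖) * ∑ j, ‖b j‖) := by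
    rw [Finset.sum_mul, Finset.mul_sum]
    refine (norm_sum_le _ _).trans (Finset.sum_le_sum fun i _ => ?_)
    rw [norm_mul, Pi.star_apply, norm_star, mul_left_comm]
    refine mul_le_mul_of_nonneg_left ?_ (norm_nonneg _)
    rw [Finset.mul_sum]
    refine (norm_sum_le _ _).trans (Finset.sum_le_sum fun j _ => ?_)
    rw [norm_mul]
    exact mul_le_mul_of_nonneg_right (hQ i j) (norm_nonneg _)
  refine h1.trans ?_
  rw [mul_assoc]
  refine mul_le_mul_of_nonneg_left ?_ hM
  set x := ∑ i, ‖a i‖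
  set y := ∑ i, ‖b i‖
  have hx := mul_le_mul_of_nonneg_left (hcs a) hθ.le
  have hy := mul_le_mul_of_nonneg_left (hcs b) (inv_pos.mpr hθ).le
  have hyoung : 2 * (x * y) ≤ θ * x ^ 2 + θ⁻¹ * y ^ 2 := by
    have h2 : θ * x ^ 2 + θ⁻¹ * y ^ 2 - 2 * (x * y) = θ * (x - θ⁻¹ * y) ^ 2 := by
      field_simp
      ring
    have h3 : 0 ≤ θ * (x - θ⁻¹ * y) ^ 2 := by positivity
    linarith
  have hxy : 0 ≤ x * y := mul_nonneg (Finset.sum_nonneg fun _ _ => norm_nonneg _)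
    (Finset.sum_nonneg fun _ _ => norm_nonneg _)
  linarith

end Form

section Estimate

variable {m n N : ℕ} {ρ : ℝ}

lemma IsMultiplier.exists_bound {P : ℂ → Matrix (Fin m ⊕ Fin n) (Fin m ⊕ Fin n) ℂ}
    (hP : IsMultiplier ρ P) : ∃ M : ℝ, 0 ≤ M ∧
      ∀ᵐ t ∂(haarAddCircle (T := (1 : ℝ))), ∀ i j, ‖P ((ρ : ℂ) * circlePt t) i j‖ ≤ M := by
  let b : Fin m ⊕ Fin n → Fin m ⊕ Fin n → ℝ := fun i j =>
    (eLpNorm (fun t : UnitAddCircle => P ((ρ : ℂ) * circlePt t) i j) ∞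
      (haarAddCircle (T := (1 : ℝ)))).toReal
  have hb : ∀ i j, 0 ≤ b i j := fun i j => ENNReal.toReal_nonneg
  refine ⟨∑ i, ∑ j, b i j, Finset.sum_nonneg fun i _ => Finset.sum_nonneg fun j _ => hb i j,
    ae_all_iff.mpr fun i => ae_all_iff.mpr fun j => ?_⟩
  have hle : b i j ≤ ∑ i, ∑ j, b i j :=
    (Finset.single_le_sum (fun j _ => hb i j) (Finset.mem_univ j)).trans
      (Finset.single_le_sum (f := fun i => ∑ j, b i j)
        (fun i _ => Finset.sum_nonneg fun j _ => hb i j) (Finset.mem_univ i))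
  filter_upwards [ae_le_eLpNormEssSup (μ := haarAddCircle (T := (1 : ℝ)))
    (f := fun t : UnitAddCircle => P ((ρ : ℂ) * circlePt t) i j)] with t ht
  refine le_trans ?_ hle
  rw [← eLpNorm_exponent_top] at ht
  have h := ENNReal.toReal_mono (hP.2 i j).eLpNorm_ne_top ht
  rwa [toReal_enorm] at h

lemma memLp_stacked (y : Signal m) (u : Signal n) (i : Fin m ⊕ Fin n) :
    MemLp (fun t => stacked ρ y u t i) 2 (haarAddCircle (T := (1 : ℝ))) := by
  cases i with
  | inl i => exact Lp.memLp (zTransform ρ y i)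
  | inr j => exact Lp.memLp (zTransform ρ u j)

lemma integrable_iqc_form {P : ℂ → Matrix (Fin m ⊕ Fin n) (Fin m ⊕ Fin n) ℂ}
    (hP : IsMultiplier ρ P) (y : Signal m) (u : Signal n) :
    Integrable (fun t : UnitAddCircle => (star (stacked ρ y u t) ⬝ᵥ
        (P ((ρ : ℂ) * circlePt t)).mulVec (stacked ρ y u t)).re) haarAddCircle := by
  have h : Integrable (fun t : UnitAddCircle => ∑ i, star (stacked ρ y u t i) *
      ∑ j, P ((ρ : ℂ) * circlePt t) i j * stacked ρ y u t j) haarAddCircle := by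
    refine integrable_finsetSum _ fun i _ => ?_
    have h2 : MemLp (fun t : UnitAddCircle => ∑ j, P ((ρ : ℂ) * circlePt t) i j *
        stacked ρ y u t j) 2 haarAddCircle :=
      memLp_finsetSum _ fun j _ => MemLp.mul' (memLp_stacked y u j) (hP.2 i j)
    have h3 : MemLp (fun t : UnitAddCircle => star (stacked ρ y u t i)) 2 haarAddCircle :=
      (memLp_stacked y u i).star
    exact MemLp.integrable_mul h3 h2
  exact h.re

lemma sum_norm_sq_stacked (y : Signal m) (u : Signal n) (t : UnitAddCircle) :
    ∑ i, ‖stacked ρ y u t i‖ ^ 2 = transformSq ρ y t + transformSq ρ u t := by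
  rw [Fintype.sum_sum_type]
  rfl

lemma FrequencyDomainInequality.re_form_le {ε : ℝ} {G : Matrix (Fin m) (Fin n) (RatFunc ℝ)}
    {P : ℂ → Matrix (Fin m ⊕ Fin n) (Fin m ⊕ Fin n) ℂ} (h : FrequencyDomainInequality ρ ε G P)
    {z : ℂ} (hz : ‖z‖ = 1) (w : Fin n → ℂ) :
    (star ((graphMatrix ρ G z).mulVec w) ⬝ᵥ
      (P ((ρ : ℂ) * z)).mulVec ((graphMatrix ρ G z).mulVec w)).re ≤ -ε * ∑ i, ‖w i‖ ^ 2 := by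
  have h1 := (Complex.le_def.mp ((h z hz).dotProduct_mulVec_nonneg w)).1
  have hw : (star w ⬝ᵥ w) = ((∑ i, ‖w i‖ ^ 2 : ℝ) : ℂ) := by
    rw [dotProduct]
    push_cast
    exact Finset.sum_congr rfl fun i _ => Complex.conj_mul' (w i)
  rw [Matrix.sub_mulVec, Matrix.neg_mulVec, Matrix.smul_mulVec, Matrix.one_mulVec, dotProduct_sub,
    dotProduct_neg, dotProduct_smul, hw, ← Matrix.mulVec_mulVec, ← Matrix.mulVec_mulVec,
    Matrix.dotProduct_mulVec, Matrix.vecMul_conjTranspose, star_star, smul_eq_mul, Complex.sub_re,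
    Complex.neg_re, ← Complex.ofReal_mul, Complex.ofReal_re, Complex.zero_re] at h1
  linarith

/-- If `v = G w + f` and the pair `(v, w)` satisfies the constraint, then the frequency domain
inequality, with `[v̂; ŵ] = [G; I] ŵ + [f̂; 0]`, bounds `v` by `f`, uniformly over all such pairs. -/
lemma exists_ell2NormSq_le_of_iqc (hρ : 0 < ρ) (S : StateSpace m n N)
    (hG : ScaledRHInf ρ S.transferMatrix)
    (hA : ∀ x, Summable fun k : ℕ => ρ⁻¹ ^ k * ‖(S.A ^ k).toEuclideanLin x‖)
    {P : ℂ → Matrix (Fin m ⊕ Fin n) (Fin m ⊕ Fin n) ℂ} (hP : IsMultiplier ρ P)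
    {ε : ℝ} (hε : 0 < ε) (hfdi : FrequencyDomainInequality ρ ε S.transferMatrix P) :
    ∃ c : ℝ, 0 ≤ c ∧ ∀ (v f : Signal m) (w : Signal n), MemEll2 ρ f →
      v = S.output 0 w + f → SignalsSatisfyIQC ρ P v w → ell2NormSq ρ v ≤ c * ell2NormSq ρ f := by
  obtain ⟨M, hM, hPM⟩ := hP.exists_bound
  obtain ⟨g, hg, hout⟩ := exists_energy_output_le hρ S hA
  set κ := M * Fintype.card (Fin m ⊕ Fin n) with hκdef
  have hκ : 0 ≤ κ := by positivity
  -- small enough for the cross terms to cost at most half of `ε ‖w‖²`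
  set θ := ε / (4 * (κ + 1) * (2 * g + 1)) with hθdef
  have hθ : 0 < θ := by positivity
  have hθε : 2 * κ * θ * (2 * g + 1) ≤ ε / 2 := by
    have h1 : θ * (4 * (κ + 1) * (2 * g + 1)) = ε := by
      rw [hθdef]; field_simp
    have h2 : 0 ≤ θ * (2 * g + 1) := by positivity
    nlinarith
  set c₁ := κ * (4 * θ + 2 * θ⁻¹ + 2)
  have hc₁ : 0 ≤ c₁ := by positivity
  refine ⟨2 * (g * (2 * ε⁻¹ * c₁) + 1), by positivity, fun v f w hf hv hiqc => ?_⟩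
  obtain ⟨hvm, hwm, hint⟩ := hiqc
  have hGw : MemEll2 ρ (S.output 0 w) := memEll2_output hρ S hA 0 hwm
  have hv2 : ell2NormSq ρ v ≤ 2 * (g * ell2NormSq ρ w + ell2NormSq ρ f) := by
    refine ell2NormSq_le_of_energy_le fun K => ?_
    rw [hv]
    refine (energy_add_le _ _ K).trans ?_
    have h1 := hout 0 w K
    rw [norm_zero, zero_pow two_ne_zero, zero_add] at h1
    have h2 := mul_le_mul_of_nonneg_left (energy_le_ell2NormSq hwm K) hg
    linarith [energy_le_ell2NormSq hf K]
  have hpt : ∀ᵐ t ∂(haarAddCircle (T := (1 : ℝ))), (star (stacked ρ v w t) ⬝ᵥ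
      (P ((ρ : ℂ) * circlePt t)).mulVec (stacked ρ v w t)).re ≤
      2 * κ * θ * transformSq ρ v t + (2 * κ * θ - ε) * transformSq ρ w t +
        κ * (2 * θ⁻¹ + 2) * transformSq ρ f t := by
    have hvadd := zTransform_add_ae hGw hf
    filter_upwards [hPM, hvadd, zTransform_output_ae hρ S hG hA hwm] with t hPt h1 h2
    set Q := P ((ρ : ℂ) * circlePt t)
    set s := stacked ρ v w t with hs
    let η : Fin m ⊕ Fin n → ℂ := Sum.elim (fun i => zTransform ρ f i t) 0
    set W := fun j => zTransform ρ w j t with hW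
    set Γ := graphMatrix ρ S.transferMatrix (circlePt t) with hΓ
    have hsη : Γ.mulVec W = s - η := by
      rw [hΓ, graphMatrix, Matrix.fromRows_mulVec, Matrix.one_mulVec, ← h2]
      funext i
      cases i with
      | inl i =>
        have := congrFun h1 i
        rw [← hv, Pi.add_apply] at this
        simp [hs, stacked, η, this]
      | inr j => simp [hs, stacked, η, hW]
    have hη : ∑ i, ‖η i‖ ^ 2 = transformSq ρ f t := by
      rw [Fintype.sum_sum_type]
      simp [η, transformSq]
    have hss : ∑ i, ‖s i‖ ^ 2 = transformSq ρ v t + transformSq ρ w t := sum_norm_sq_stacked v w t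
    have hfd := hfdi.re_form_le (norm_circlePt t) W
    rw [← hΓ, hsη] at hfd
    change (star (s - η) ⬝ᵥ Q.mulVec (s - η)).re ≤ -ε * transformSq ρ w t at hfd
    have hexp : star (s - η) ⬝ᵥ Q.mulVec (s - η) = star s ⬝ᵥ Q.mulVec s - star s ⬝ᵥ Q.mulVec η -
        star η ⬝ᵥ Q.mulVec s + star η ⬝ᵥ Q.mulVec η := by
      rw [star_sub, Matrix.mulVec_sub, sub_dotProduct, dotProduct_sub, dotProduct_sub]
      ring
    rw [hexp] at hfd
    simp only [Complex.add_re, Complex.sub_re] at hfd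
    have b1 := (Complex.re_le_norm _).trans (norm_star_dotProduct_mulVec_le hM hθ hPt s η)
    have b2 := (Complex.re_le_norm _).trans
      (norm_star_dotProduct_mulVec_le hM (inv_pos.mpr hθ) hPt η s)
    have b3 := (neg_le_abs _).trans ((Complex.abs_re_le_norm _).trans
      (norm_star_dotProduct_mulVec_le hM one_pos hPt η η))
    rw [← hκdef, hη, hss] at b1 b2
    rw [← hκdef, hη] at b3
    rw [inv_inv] at b2
    rw [inv_one] at b3
    nlinarith
  have hint2 : 0 ≤ ∫ t, (2 * κ * θ * transformSq ρ v t + (2 * κ * θ - ε) * transformSq ρ w t +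
        κ * (2 * θ⁻¹ + 2) * transformSq ρ f t) ∂(haarAddCircle (T := (1 : ℝ))) := by
    refine hint.trans (integral_mono_ae (integrable_iqc_form hP v w) ?_ hpt)
    exact (((integrable_transformSq v).const_mul _).add
      ((integrable_transformSq w).const_mul _)).add ((integrable_transformSq f).const_mul _)
  have hvw : Integrable (fun t => 2 * κ * θ * transformSq ρ v t +
      (2 * κ * θ - ε) * transformSq ρ w t) (haarAddCircle (T := (1 : ℝ))) :=
    ((integrable_transformSq v).const_mul _).add ((integrable_transformSq w).const_mul _)
  rw [integral_add hvw ((integrable_transformSq f).const_mul _),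
    integral_add ((integrable_transformSq v).const_mul _)
      ((integrable_transformSq w).const_mul _), integral_const_mul, integral_const_mul,
    integral_const_mul, integral_transformSq hvm, integral_transformSq hwm,
    integral_transformSq hf] at hint2
  have hw0 := ell2NormSq_nonneg (ρ := ρ) w
  have hκθ : 0 ≤ 2 * κ * θ := by positivity
  have h3 := mul_le_mul_of_nonneg_left hv2 hκθ
  have h4 := mul_le_mul_of_nonneg_right hθε hw0
  have hw2 : ε / 2 * ell2NormSq ρ w ≤ c₁ * ell2NormSq ρ f := by
    simp only [c₁]
    nlinarith
  have hw3 : ell2NormSq ρ w ≤ 2 * ε⁻¹ * c₁ * ell2NormSq ρ f := by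
    calc ell2NormSq ρ w = 2 * ε⁻¹ * (ε / 2 * ell2NormSq ρ w) := by field_simp
      _ ≤ 2 * ε⁻¹ * (c₁ * ell2NormSq ρ f) := by gcongr
      _ = _ := by ring
  have h5 := mul_le_mul_of_nonneg_left hw3 hg
  linarith

end Estimate

/-! ### Homotopy from the open loop -/

section Homotopy

variable {m n N : ℕ} {ρ : ℝ}

/-- Eliminating `w` from a well-posed interconnection with `e = 0` leaves the equation
`v = G Φ(v) + f`, which is solved uniquely and causally. -/
lemma WellPosed.exists_causal_solution {S : StateSpace m n N} {Φ : Signal m → Signal n}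
    (h : WellPosed S Φ) : ∃ R : Signal m → Signal m, Causal R ∧
      ∀ v f, v = S.output 0 (Φ v) + f ↔ v = R f := by
  obtain ⟨H, hl, hr, hc⟩ := h
  refine ⟨fun f k => (H (fun j => (0, f j)) k).1, ?_, fun v f => ⟨fun hv => ?_, fun hv => ?_⟩⟩
  · intro p q T hpq
    exact congrArg Prod.fst (hc _ _ T fun k hk => by rw [hpq k hk])
  · have hp : loopMap S Φ (fun k => (v k, Φ v k)) = fun k => (0, f k) := by
      funext k
      refine Prod.ext (sub_self _) ?_
      change v k - S.output 0 (Φ v) k = f k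
      rw [sub_eq_iff_eq_add']
      exact congrFun hv k
    funext k
    have := congrFun (hl fun k => (v k, Φ v k)) k
    rw [hp] at this
    exact (congrArg Prod.fst this).symm
  · set p := H fun j => (0, f j) with hp
    have hloop : loopMap S Φ p = fun j => (0, f j) := hr _
    have hv' : (fun k => (p k).1) = v := hv.symm
    have h2 : (fun k => (p k).2) = Φ v := by
      funext k
      have := congrArg Prod.fst (congrFun hloop k)
      change (p k).2 - Φ (fun j => (p j).1) k = 0 at this
      rw [← hv']
      exact sub_eq_zero.mp this
    funext k
    have := congrArg Prod.snd (congrFun hloop k)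
    change (p k).1 - S.output 0 (fun j => (p j).2) k = f k at this
    rw [h2, sub_eq_iff_eq_add'] at this
    exact (congrFun hv' k).symm.trans this

lemma Causal.energy_le {Δ : Signal m → Signal n} (hΔc : Causal Δ) {γ : ℝ}
    (hγ : ∀ y : Signal m, MemEll2 ρ y →
      MemEll2 ρ (Δ y) ∧ ell2NormSq ρ (Δ y) ≤ γ ^ 2 * ell2NormSq ρ y) (y : Signal m) (K : ℕ) :
    energy ρ (Δ y) K ≤ γ ^ 2 * energy ρ y K := by
  obtain ⟨h1, h2⟩ := hγ _ (memEll2_truncate y K)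
  have h3 : energy ρ (Δ y) K = energy ρ (Δ (truncate y K)) K :=
    energy_congr fun k hk => hΔc _ _ k fun j hj => (truncate_of_lt y (hj.trans_lt hk)).symm
  rw [h3]
  refine (energy_le_ell2NormSq h1 K).trans (h2.trans ?_)
  exact mul_le_mul_of_nonneg_left (ell2NormSq_truncate_le y K) (sq_nonneg γ)

/-- One step of the homotopy. The bound `c` is known only for loops whose signals are already in
`ℓ₂^ρ`; truncating the perturbed equation and using causality reduces the loop at `τ'` to such
signals of the loop at `τ`. -/
lemma memEll2_of_nearby {S : StateSpace m n N} {Δ : Signal m → Signal n} {c g γ δ τ τ' : ℝ}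
    (hc : 0 ≤ c) (hg : 0 ≤ g)
    (hout : ∀ (u : Signal n) (K : ℕ), energy ρ (S.output 0 u) K ≤ g * energy ρ u K)
    (hΔ : ∀ (y : Signal m) (K : ℕ), energy ρ (Δ y) K ≤ γ ^ 2 * energy ρ y K)
    (hδ : δ ^ 2 * (4 * c * g * γ ^ 2) ≤ 1) (hτ : |τ' - τ| ≤ δ)
    (hwp : WellPosed S (τ • Δ))
    (hbound : ∀ v f : Signal m, MemEll2 ρ v → MemEll2 ρ f →
      v = S.output 0 ((τ • Δ) v) + f → ell2NormSq ρ v ≤ c * ell2NormSq ρ f)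
    (hmem : ∀ v f : Signal m, MemEll2 ρ f → v = S.output 0 ((τ • Δ) v) + f → MemEll2 ρ v)
    (v f : Signal m) (hf : MemEll2 ρ f) (hv : v = S.output 0 ((τ' • Δ) v) + f) :
    MemEll2 ρ v := by
  obtain ⟨R, hRc, hR⟩ := hwp.exists_causal_solution
  set h := f + (τ' - τ) • S.output 0 (Δ v) with hh
  have hvh : v = S.output 0 ((τ • Δ) v) + h := by
    have e1 : S.output 0 ((τ • Δ) v) = τ • S.output 0 (Δ v) := S.output_zero_smul τ (Δ v)
    have e2 : S.output 0 ((τ' • Δ) v) = τ' • S.output 0 (Δ v) := S.output_zero_smul τ' (Δ v)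
    rw [e2] at hv
    rw [e1, hh, sub_smul]
    nth_rw 1 [hv]
    abel
  refine memEll2_of_energy_le (c := 4 * c * ell2NormSq ρ f) fun K => ?_
  set v' := R (truncate h K) with hv'
  have hv'eq := (hR v' (truncate h K)).mpr hv'
  have hv'mem := hmem v' _ (memEll2_truncate h K) hv'eq
  have hagree : energy ρ v K = energy ρ v' K := by
    refine energy_congr fun k hk => ?_
    rw [(hR v h).mp hvh]
    exact hRc _ _ k fun j hj => (truncate_of_lt h (hj.trans_lt hk)).symm
  have h1 : energy ρ v K ≤ c * energy ρ h K := by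
    rw [hagree]
    refine (energy_le_ell2NormSq hv'mem K).trans
      ((hbound v' _ hv'mem (memEll2_truncate h K) hv'eq).trans ?_)
    exact mul_le_mul_of_nonneg_left (ell2NormSq_truncate_le h K) hc
  have h2 : energy ρ h K ≤ 2 * (energy ρ f K + δ ^ 2 * (g * (γ ^ 2 * energy ρ v K))) := by
    refine (energy_add_le _ _ K).trans ?_
    rw [energy_smul]
    have hsq : (τ' - τ) ^ 2 ≤ δ ^ 2 := sq_le_sq' (by linarith [(abs_le.mp hτ).1]) (abs_le.mp hτ).2
    have h3 : energy ρ (S.output 0 (Δ v)) K ≤ g * (γ ^ 2 * energy ρ v K) :=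
      (hout _ K).trans (mul_le_mul_of_nonneg_left (hΔ v K) hg)
    have h4 := mul_le_mul hsq h3 (energy_nonneg _ _) (sq_nonneg δ)
    linarith
  have hv0 := energy_nonneg (ρ := ρ) v K
  have h5 := mul_le_mul_of_nonneg_left h2 hc
  have h6 := mul_le_mul_of_nonneg_right hδ hv0
  have h7 := mul_le_mul_of_nonneg_left (energy_le_ell2NormSq hf K) hc
  nlinarith

/-- Bounded loops at `τ = 0` stay bounded up to `τ = 1` when the a priori bound is uniform
in `τ`. -/
lemma memEll2_of_uniform_bound {S : StateSpace m n N} {Δ : Signal m → Signal n} {c g γ : ℝ}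
    (hc : 0 ≤ c) (hg : 0 ≤ g)
    (hout : ∀ (u : Signal n) (K : ℕ), energy ρ (S.output 0 u) K ≤ g * energy ρ u K)
    (hΔ : ∀ (y : Signal m) (K : ℕ), energy ρ (Δ y) K ≤ γ ^ 2 * energy ρ y K)
    (hwp : ∀ τ ∈ Set.Icc (0 : ℝ) 1, WellPosed S (τ • Δ))
    (hbound : ∀ τ ∈ Set.Icc (0 : ℝ) 1, ∀ v f : Signal m, MemEll2 ρ v → MemEll2 ρ f →
      v = S.output 0 ((τ • Δ) v) + f → ell2NormSq ρ v ≤ c * ell2NormSq ρ f)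
    (v f : Signal m) (hf : MemEll2 ρ f) (hv : v = S.output 0 (Δ v) + f) : MemEll2 ρ v := by
  set L := 4 * c * g * γ ^ 2
  have hL : 0 ≤ L := by positivity
  -- `p + 1` steps, so that one step is short enough for `memEll2_of_nearby`
  obtain ⟨p, hp⟩ := exists_nat_gt L
  set q : ℝ := (p : ℝ) + 1
  have hq : 1 ≤ q := by simp [q]
  have hq0 : 0 < q := by linarith
  have hδ : (q⁻¹) ^ 2 * L ≤ 1 := by
    rw [inv_pow, inv_mul_le_iff₀ (by positivity)]
    simp only [q] at hq ⊢
    nlinarith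
  have key : ∀ k : ℕ, k ≤ p + 1 → ∀ v f : Signal m, MemEll2 ρ f →
      v = S.output 0 ((((k : ℝ) / q) • Δ) v) + f → MemEll2 ρ v := by
    intro k
    induction k with
    | zero =>
      intro _ v f hf hv
      have h0 : S.output 0 (((((0 : ℕ) : ℝ) / q) • Δ) v) = 0 := by
        have := S.output_zero_smul (((0 : ℕ) : ℝ) / q) (Δ v)
        rw [Nat.cast_zero, zero_div, zero_smul] at this ⊢
        rw [zero_smul] at this
        exact this
      rw [h0, zero_add] at hv
      rwa [hv]
    | succ k ih =>
      intro hk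
      have hmem : (k : ℝ) / q ∈ Set.Icc (0 : ℝ) 1 := by
        refine ⟨by positivity, ?_⟩
        rw [div_le_one hq0]
        have : (k : ℝ) + 1 ≤ p + 1 := by exact_mod_cast hk
        simp only [q]
        linarith
      refine memEll2_of_nearby hc hg hout hΔ hδ ?_ (hwp _ hmem) (hbound _ hmem)
        (ih (by omega))
      rw [← sub_div]
      push_cast
      rw [add_sub_cancel_left, one_div, abs_of_pos (inv_pos.mpr hq0)]
  refine key (p + 1) le_rfl v f hf ?_
  have : ((p + 1 : ℕ) : ℝ) / q = 1 := by
    push_cast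
    exact div_self hq0.ne'
  rwa [this, one_smul]

end Homotopy

end RhoIQC

theorem theorem2 {m n N : ℕ} (ρ : ℝ) (hρ0 : 0 < ρ) (hρ1 : ρ < 1)
    (G : Matrix (Fin m) (Fin n) (RatFunc ℝ)) (hG : RhoIQC.ScaledRHInf ρ G)
    (S : RhoIQC.StateSpace m n N) (hS : S.IsMinimalRealization G)
    (Δ : RhoIQC.Signal m → RhoIQC.Signal n)
    (hΔc : RhoIQC.Causal Δ) (hΔb : RhoIQC.BoundedOn ρ Δ)
    (P : ℂ → Matrix (Fin m ⊕ Fin n) (Fin m ⊕ Fin n) ℂ) (hP : RhoIQC.IsMultiplier ρ P)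
    (hwp : ∀ τ ∈ Set.Icc (0 : ℝ) 1, RhoIQC.WellPosed S (τ • Δ))
    (hiqc : ∀ τ ∈ Set.Icc (0 : ℝ) 1, RhoIQC.SatisfiesIQC ρ P (τ • Δ))
    (hfdi : ∃ ε : ℝ, 0 < ε ∧ RhoIQC.FrequencyDomainInequality ρ ε G P) :
    RhoIQC.ExponentiallyStable S Δ ρ := by
  open RhoIQC in
  obtain ⟨ε, hε, hfdi⟩ := hfdi
  obtain ⟨γ, hγ⟩ := hΔb
  have hA := fun x => summable_norm_pow hρ0 hS hG x
  rw [← hS.1] at hG hfdi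
  obtain ⟨c, hc, hiq⟩ := exists_ell2NormSq_le_of_iqc hρ0 S hG hA hP hε hfdi
  obtain ⟨g, hg, hout⟩ := exists_energy_output_le hρ0 S hA
  obtain ⟨s, hs, hstate⟩ := exists_energy_stateSeq_le hρ0 S hA
  have hbound : ∀ τ ∈ Set.Icc (0 : ℝ) 1, ∀ v f : Signal m, MemEll2 ρ v → MemEll2 ρ f →
      v = S.output 0 ((τ • Δ) v) + f → ell2NormSq ρ v ≤ c * ell2NormSq ρ f :=
    fun τ hτ v f hv hf heq => hiq v f _ hf heq (hiqc τ hτ v hv)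
  have hout0 : ∀ (u : Signal n) (K : ℕ), energy ρ (S.output 0 u) K ≤ g * energy ρ u K := by
    intro u K
    simpa using hout 0 u K
  have h1mem : (1 : ℝ) ∈ Set.Icc (0 : ℝ) 1 := ⟨zero_le_one, le_rfl⟩
  set κ := s * (1 + γ ^ 2 * (c * g))
  have hκ : 0 ≤ κ := by positivity
  refine ⟨√κ + 1, by positivity, fun x₀ => ⟨?_, fun u hu k => ?_⟩⟩
  · obtain ⟨R, -, hR⟩ := (hwp 1 h1mem).exists_causal_solution
    have hv := (hR _ (S.output x₀ 0)).mpr rfl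
    rw [one_smul] at hv
    refine ⟨Δ (R (S.output x₀ 0)), ?_⟩
    rw [IsFreeSolution, S.output_eq_add x₀ (Δ _), ← hv]
  · -- the free response `C Aᵏ x₀` acts as the external input of the loop started at zero
    have hf : ∀ K, energy ρ (S.output x₀ 0) K ≤ g * ‖x₀‖ ^ 2 := by
      intro K
      simpa [energy] using hout x₀ 0 K
    have hfm : MemEll2 ρ (S.output x₀ 0) := memEll2_of_energy_le hf
    set y := S.output x₀ u with hy
    have hyeq : y = S.output 0 (Δ y) + S.output x₀ 0 := by
      rw [← hu, ← S.output_eq_add x₀]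
    have hym : MemEll2 ρ y := memEll2_of_uniform_bound hc hg hout0
      (fun y K => hΔc.energy_le hγ y K) hwp hbound y _ hfm hyeq
    have hyle : ell2NormSq ρ y ≤ c * (g * ‖x₀‖ ^ 2) := by
      refine (hbound 1 h1mem y _ hym hfm (by rwa [one_smul])).trans ?_
      exact mul_le_mul_of_nonneg_left (ell2NormSq_le_of_energy_le hf) hc
    have hule : energy ρ u k ≤ γ ^ 2 * (c * (g * ‖x₀‖ ^ 2)) := by
      rw [hu]
      refine (energy_le_ell2NormSq (hγ y hym).1 k).trans ((hγ y hym).2.trans ?_)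
      exact mul_le_mul_of_nonneg_left hyle (sq_nonneg γ)
    have hx : (ρ⁻¹ ^ k * ‖S.stateSeq x₀ u k‖) ^ 2 ≤ κ * ‖x₀‖ ^ 2 := by
      have h1 : (ρ⁻¹ ^ k * ‖S.stateSeq x₀ u k‖) ^ 2 ≤ energy ρ (S.stateSeq x₀ u) (k + 1) :=
        Finset.single_le_sum (f := fun k => (ρ⁻¹ ^ k * ‖S.stateSeq x₀ u k‖) ^ 2)
          (fun _ _ => sq_nonneg _) (Finset.self_mem_range_succ k)
      refine (h1.trans (hstate x₀ u k)).trans ?_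
      calc s * (‖x₀‖ ^ 2 + energy ρ u k)
          ≤ s * (‖x₀‖ ^ 2 + γ ^ 2 * (c * (g * ‖x₀‖ ^ 2))) := by gcongr
        _ = κ * ‖x₀‖ ^ 2 := by simp only [κ]; ring
    have hx' : ρ⁻¹ ^ k * ‖S.stateSeq x₀ u k‖ ≤ √κ * ‖x₀‖ := by
      refine le_of_sq_le_sq ?_ (by positivity)
      rw [mul_pow (√κ), Real.sq_sqrt hκ]
      exact hx
    calc ‖S.stateSeq x₀ u k‖ = ρ ^ k * (ρ⁻¹ ^ k * ‖S.stateSeq x₀ u k‖) := by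
          rw [← mul_assoc, ← mul_pow, mul_inv_cancel₀ hρ0.ne', one_pow, one_mul]
      _ ≤ ρ ^ k * ((√κ + 1) * ‖x₀‖) := by
          refine mul_le_mul_of_nonneg_left (hx'.trans ?_) (by positivity)
          gcongr
          linarith
      _ = (√κ + 1) * ρ ^ k * ‖x₀‖ := by ring
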